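/- Let $f\colon Y\to X$ be a morphism of schemes. For a scheme $S$ let $\mathbf{\acute Et}_{/S}$ be its (small) étale site; for $U\in\mathbf{\acute Et}_{/X}$ put $U_Y=U\times_XY$. *The site $D$ and the co-vanishing topos.* Let $D$ be the category whose objects are the morphisms $V\to U$ over $f$ with $U$ étale over $X$ and $V$ étale over $Y$ (equivalently, $U\in\mathbf{\acute Et}_{/X}$ together with a morphism $V\to U_Y$ of $\mathbf{\acute Et}_{/Y}$), and whose morphisms $(V'\to U')\to(V\to U)$ are the pairs consisting of an $X$-morphism $U'\to U$ and a $Y$-morphism $V'\to V$ that form a commutative square. A family $\big((V_i\to U_i)\to(V\to U)\big)_i$ is called *vertical* if every $U_i\to U$ is an isomorphism and $(V_i\to V)_i$ is an étale covering, and *cartesian* if $(U_i\to U)_i$ is an étale covering and $V_i\to V\times_UU_i$ is an isomorphism for every $i$. The co-vanishing topology on $D$ is the topology generated by the vertical and the cartesian families; the topos of sheaves of sets on $D$ is the co-vanishing topos $X_{\text{ét}}\overset{\leftarrow}{\times}_{X_{\text{ét}}}Y_{\text{ét}}$. *The Faltings topos.* Let $E$ be the full subcategory of $D$ of the objects $V\to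 U$ for which $V\to U_Y$ is finite étale, equipped with the topology generated by the vertical and the cartesian families whose members all belong to $E$; the Faltings topos $\widetilde E$ is the topos of sheaves of sets on $E$. The inclusion $\rho^+\colon E\to D$ is continuous; let $\rho_*\colon X_{\text{ét}}\overset{\leftarrow}{\times}_{X_{\text{ét}}}Y_{\text{ét}}\to\widetilde E$, $F\mapsto F\circ\rho^+$, be the direct image functor, and let $\rho^*$ be its left adjoint, the pullback functor. A scheme $Y$ is *coherent* if it is quasi-compact and quasi-separated, and *étale-locally connected* if for every étale morphism $Y'\to Y$, every connected component of $Y'$ is open in $Y'$. **Proposition.** Suppose that $X$ is quasi-separated and that $Y$ is coherent and étale-locally connected. Then $\rho_*$ has a left adjoint $$\rho^*\colon\widetilde E\longrightarrow X_{\text{ét}}\overset{\leftarrow}{\times}_{X_{\text{ét}}}Y_{\text{ét}},$$ and $\rho^*$ is fully faithful. -/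

import Mathlib

open CategoryTheory Limits AlgebraicGeometry

universe v₁ v₂ u₁ u₂ u

/-! ### The co-vanishing topology

For a functor `F : A ⥤ B` between sites `(A, J)` and `(B, K)` (think of `A = Ét(X)`, `B = Ét(Y)` and
`F` the base change along `Y ⟶ X`), the category `Comma (𝟭 B) F` has as objects the triples
`(U, V, V ⟶ F(U))` with `U = Z.right` in `A`, `V = Z.left` in `B`, and the structure map `Z.hom`;
morphisms are the pairs `(V' ⟶ V, U' ⟶ U)` making the evident square commute. -/

namespace Covanishing

/-- A family of morphisms `(Vᵢ ⟶ Uᵢ) ⟶ (V ⟶ U)` is vertical if all the `Uᵢ ⟶ U` are isomorphisms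
and `(Vᵢ ⟶ V)` is a covering family of `V`. -/
structure IsVertical {A : Type u₁} [Category.{v₁} A] {B : Type u₂} [Category.{v₂} B] {F : A ⥤ B}
    (K : GrothendieckTopology B) {Z : Comma (𝟭 B) F} (R : Presieve Z) : Prop where
  isIso_right : ∀ ⦃W : Comma (𝟭 B) F⦄ (g : W ⟶ Z), R g → IsIso g.right
  covering_left : Sieve.generate (R.map (Comma.fst (𝟭 B) F)) ∈ K Z.left

/-- A family of morphisms `(Vᵢ ⟶ Uᵢ) ⟶ (V ⟶ U)` is cartesian if `(Uᵢ ⟶ U)` is a covering family of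
`U` and, for each `i`, the canonical map from `Vᵢ` to the fibre product of `V` and `F(Uᵢ)` over
`F(U)` is an isomorphism. -/
structure IsCartesian {A : Type u₁} [Category.{v₁} A] {B : Type u₂} [Category.{v₂} B] {F : A ⥤ B}
    (J : GrothendieckTopology A) {Z : Comma (𝟭 B) F} (R : Presieve Z) : Prop where
  covering_right : Sieve.generate (R.map (Comma.snd (𝟭 B) F)) ∈ J Z.right
  isPullback : ∀ ⦃W : Comma (𝟭 B) F⦄ (g : W ⟶ Z), R g →
    IsPullback g.left W.hom Z.hom (F.map g.right)

/-- The vertical and the cartesian covering families. The co-vanishing topology is the topology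
generated by them. -/
def precoverage {A : Type u₁} [Category.{v₁} A] {B : Type u₂} [Category.{v₂} B] (F : A ⥤ B)
    (J : GrothendieckTopology A) (K : GrothendieckTopology B) :
    Precoverage (Comma (𝟭 B) F) where
  coverings _ := {R | IsVertical K R ∨ IsCartesian J R}

section Stability

variable {A : Type u₁} [Category.{v₁} A] {B : Type u₂} [Category.{v₂} B]

instance [HasPullbacks A] [HasPullbacks B] (F : A ⥤ B) [PreservesLimitsOfShape WalkingCospan F] :
    PreservesLimitsOfShape WalkingCospan (Comma.fst (𝟭 B) F) where
  preservesLimit := preservesLimit_of_preserves_limit_cone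
      (Comma.coneOfPreservesIsLimit _ (limit.isLimit _) (limit.isLimit _))
      (limit.isLimit _)

instance [HasPullbacks A] [HasPullbacks B] (F : A ⥤ B) [PreservesLimitsOfShape WalkingCospan F] :
    PreservesLimitsOfShape WalkingCospan (Comma.snd (𝟭 B) F) where
  preservesLimit := preservesLimit_of_preserves_limit_cone
      (Comma.coneOfPreservesIsLimit _ (limit.isLimit _) (limit.isLimit _))
      (limit.isLimit _)

lemma generate_ofArrows_mem_of_isPullback {C : Type*} [Category* C] (J : GrothendieckTopology C)
    {ι : Type*} {S : C} {X : ι → C} (f : ∀ i, X i ⟶ S)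
    (hf : Sieve.generate (Presieve.ofArrows X f) ∈ J S) {Y : C} (g : Y ⟶ S) {P : ι → C}
    (p₁ : ∀ i, P i ⟶ Y) (p₂ : ∀ i, P i ⟶ X i) (h : ∀ i, IsPullback (p₁ i) (p₂ i) g (f i)) :
    Sieve.generate (Presieve.ofArrows P p₁) ∈ J Y := by
  refine J.superset_covering ?_ (J.pullback_stable g hf)
  rintro T t ⟨_, a, _, ⟨i⟩, hc⟩
  exact ⟨P i, (h i).lift t a hc.symm, p₁ i, ⟨i⟩, (h i).lift_fst _ _ _⟩

/-- Vertical and cartesian covering families are stable under base change. -/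
instance (F : A ⥤ B) (J : GrothendieckTopology A) (K : GrothendieckTopology B)
    [HasPullbacks A] [HasPullbacks B] [PreservesLimitsOfShape WalkingCospan F] :
    (precoverage F J K).IsStableUnderBaseChange where
  mem_coverings_of_isPullback := by
    intro ι S X f hf T g P p₁ p₂ h
    have hl i := (h i).map (Comma.fst (𝟭 B) F)
    have hr i := (h i).map (Comma.snd (𝟭 B) F)
    rcases hf with ⟨h1, h2⟩ | ⟨h1, h2⟩
    · left
      constructor
      · rintro _ _ ⟨i⟩
        have : IsIso ((Comma.snd (𝟭 B) F).map (f i)) := h1 _ ⟨i⟩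
        exact (hr i).isIso_fst_of_isIso
      · rw [Presieve.map_ofArrows] at h2 ⊢
        exact generate_ofArrows_mem_of_isPullback K _ h2 _ _ _ hl
    · right
      constructor
      · rw [Presieve.map_ofArrows] at h1 ⊢
        exact generate_ofArrows_mem_of_isPullback J _ h1 _ _ _ hr
      · rintro _ _ ⟨i⟩
        have h3 := (hl i).flip.paste_horiz (h2 _ (Presieve.ofArrows.mk i)).flip
        have h4 := ((hr i).map F).flip
        have h5 : (p₂ i).left ≫ (X i).hom = (P i).hom ≫ F.map (p₂ i).right := (p₂ i).w
        have h6 : g.left ≫ S.hom = T.hom ≫ F.map g.right := g.w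
        have h7 : IsPullback ((p₂ i).left ≫ (X i).hom) (p₁ i).left (F.map (f i).right)
            (g.left ≫ S.hom) := h3
        rw [h5, h6] at h7
        exact (IsPullback.of_right h7 (p₁ i).w.symm h4).flip

instance (F : A ⥤ B) (J : GrothendieckTopology A) (K : GrothendieckTopology B)
    [HasPullbacks A] [HasPullbacks B] [PreservesLimitsOfShape WalkingCospan F] :
    (precoverage F J K).HasPullbacks where
  hasPullbacks_of_mem _ _ := inferInstance

end Stability

end Covanishing

/-! ### The Faltings site and its morphism to the co-vanishing site -/

namespace Faltings

/-- Base change of objects along `f`, for a morphism property `P` stable under base change. -/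
noncomputable def overPullback {C : Type u₁} [Category.{v₁} C] [HasPullbacks C]
    (P : MorphismProperty C) [P.IsStableUnderBaseChange] {X Y : C} (f : Y ⟶ X) :
    P.Over ⊤ X ⥤ P.Over ⊤ Y :=
  MorphismProperty.Over.pullback P ⊤ f

noncomputable def overPullbackForget {C : Type u₁} [Category.{v₁} C] [HasPullbacks C]
    (P : MorphismProperty C) [P.IsStableUnderBaseChange] {X Y : C} (f : Y ⟶ X) :
    overPullback P f ⋙ MorphismProperty.Over.forget P ⊤ Y ≅
      MorphismProperty.Over.forget P ⊤ X ⋙ Over.pullback f :=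
  MorphismProperty.Over.pullbackCompForgetIso f

/-- The functor `f⁺ : Ét(X) ⥤ Ét(Y)`, `U ↦ U_Y = U ×[X] Y`, for a morphism `f : Y ⟶ X`. -/
noncomputable def etalePullback {X Y : Scheme.{u}} (f : Y ⟶ X) : X.Etale ⥤ Y.Etale :=
  overPullback @Etale f

noncomputable def etalePullbackForget {X Y : Scheme.{u}} (f : Y ⟶ X) :
    etalePullback f ⋙ Scheme.Etale.forget Y ≅ Scheme.Etale.forget X ⋙ Over.pullback f :=
  overPullbackForget @Etale f

instance {X Y : Scheme.{u}} (f : Y ⟶ X) : PreservesFiniteLimits (etalePullback f) := by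
  have : PreservesFiniteLimits (etalePullback f ⋙ Scheme.Etale.forget Y) :=
    preservesFiniteLimits_of_natIso (etalePullbackForget f).symm
  exact preservesFiniteLimits_of_reflects_of_preserves _ (Scheme.Etale.forget Y)

/-- The category underlying the co-vanishing site of `f`: its objects are the pairs of an étale
`X`-scheme `U` and an étale `Y`-scheme `V` with a `Y`-morphism `V ⟶ U_Y`. -/
abbrev CovanishingCat {X Y : Scheme.{u}} (f : Y ⟶ X) := Comma (𝟭 Y.Etale) (etalePullback f)

/-- The vertical families (`Uᵢ ≅ U` and `(Vᵢ ⟶ V)` an étale covering) and the cartesian families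
(`(Uᵢ ⟶ U)` an étale covering, `Vᵢ ≅ V ×[U] Uᵢ`). -/
noncomputable def covPrecoverage {X Y : Scheme.{u}} (f : Y ⟶ X) : Precoverage (CovanishingCat f) :=
  Covanishing.precoverage (etalePullback f) X.smallEtaleTopology Y.smallEtaleTopology

/-- The co-vanishing topology, generated by the vertical and the cartesian families. Its topos of
sheaves is the co-vanishing topos of `f`. -/
noncomputable def covTopology {X Y : Scheme.{u}} (f : Y ⟶ X) : GrothendieckTopology (CovanishingCat f) :=
  (covPrecoverage f).toGrothendieck

/-- The objects `V ⟶ U_Y` for which `V` is finite (hence finite étale) over `U_Y`. -/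
def finiteObjects {X Y : Scheme.{u}} (f : Y ⟶ X) : ObjectProperty (CovanishingCat f) :=
  fun Z => IsFinite Z.hom.left

/-- The category underlying the Faltings site of `f`: its objects are the morphisms `V ⟶ U` over
`f : Y ⟶ X` with `U` étale over `X` and `V ⟶ U_Y` finite étale; its morphisms are the commutative
squares. -/
abbrev FaltingsCat {X Y : Scheme.{u}} (f : Y ⟶ X) := (finiteObjects f).FullSubcategory

/-- The inclusion `ρ⁺` of the Faltings site in the co-vanishing site. -/
noncomputable abbrev rhoPlus {X Y : Scheme.{u}} (f : Y ⟶ X) : FaltingsCat f ⥤ CovanishingCat f :=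
  (finiteObjects f).ι

/-- The vertical and the cartesian covering families all of whose members are in `FaltingsCat f`. -/
noncomputable def faltingsPrecoverage {X Y : Scheme.{u}} (f : Y ⟶ X) : Precoverage (FaltingsCat f) :=
  (covPrecoverage f).comap (rhoPlus f)

/-- The topology of the Faltings site: the one generated, on the category `FaltingsCat f`, by the
vertical and cartesian families of that category. (By definition it is not the topology induced by
that of the co-vanishing site.) -/
noncomputable def faltingsTopology {X Y : Scheme.{u}} (f : Y ⟶ X) : GrothendieckTopology (FaltingsCat f) :=
  (faltingsPrecoverage f).toGrothendieck

instance {X Y : Scheme.{u}} (f : Y ⟶ X) : (covPrecoverage f).IsStableUnderBaseChange := by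
  unfold covPrecoverage; infer_instance

lemma isFinite_of_isPullback {VP VA VB VC UP UA UB UC : Scheme.{u}}
    {p₁ : VP ⟶ VA} {p₂ : VP ⟶ VB} {a : VA ⟶ VC} {b : VB ⟶ VC} (hV : IsPullback p₁ p₂ a b)
    {q₁ : UP ⟶ UA} {q₂ : UP ⟶ UB} {c : UA ⟶ UC} {d : UB ⟶ UC} (hU : IsPullback q₁ q₂ c d)
    {hA : VA ⟶ UA} {hB : VB ⟶ UB} {hC : VC ⟶ UC} {hP : VP ⟶ UP}
    (w₁ : p₁ ≫ hA = hP ≫ q₁) (w₂ : p₂ ≫ hB = hP ≫ q₂) (w₃ : a ≫ hC = hA ≫ c)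
    (w₄ : b ≫ hC = hB ≫ d) [IsFinite hA] [IsFinite hB] [IsFinite hC] : IsFinite hP := by
  let m : VA ⟶ pullback hC c := pullback.lift a hA w₃
  have hm : IsFinite m := by
    have : IsFinite (m ≫ pullback.snd hC c) := by
      rw [pullback.lift_snd]; infer_instance
    exact IsFinite.of_comp m (pullback.snd hC c)
  let l : VP ⟶ pullback q₂ hB := pullback.lift hP p₂ w₂.symm
  have wk : (pullback.snd q₂ hB ≫ b) ≫ hC = (pullback.fst q₂ hB ≫ q₁) ≫ c := by
    rw [Category.assoc, w₄, Category.assoc, hU.w, pullback.condition_assoc]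
  let k : pullback q₂ hB ⟶ pullback hC c :=
    pullback.lift (pullback.snd q₂ hB ≫ b) (pullback.fst q₂ hB ≫ q₁) wk
  have hk₁ : k ≫ pullback.fst hC c = pullback.snd q₂ hB ≫ b := pullback.lift_fst _ _ _
  have hk₂ : k ≫ pullback.snd hC c = pullback.fst q₂ hB ≫ q₁ := pullback.lift_snd _ _ _
  have s₁ := (IsPullback.of_hasPullback q₂ hB).paste_horiz hU
  rw [← hk₂, ← w₄] at s₁
  have s₂ := IsPullback.of_right s₁ hk₁ (IsPullback.of_hasPullback hC c).flip
  have hl : l ≫ pullback.snd q₂ hB = p₂ := pullback.lift_snd _ _ _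
  have hm₁ : m ≫ pullback.fst hC c = a := pullback.lift_fst _ _ _
  have s₃ := hV.flip
  rw [← hl, ← hm₁] at s₃
  have hlk : l ≫ k = p₁ ≫ m := by
    apply pullback.hom_ext
    · rw [Category.assoc, hk₁, Category.assoc, hm₁, reassoc_of% hl, hV.w]
    · rw [Category.assoc, hk₂, Category.assoc, pullback.lift_snd, pullback.lift_fst_assoc, w₁]
  have s₄ := IsPullback.of_right s₃ hlk s₂.flip
  have : IsFinite l := MorphismProperty.of_isPullback s₄.flip hm
  have hP' : hP = l ≫ pullback.fst q₂ hB := (pullback.lift_fst _ _ _).symm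
  rw [hP']
  infer_instance

instance {X Y : Scheme.{u}} (f : Y ⟶ X) :
    (finiteObjects f).IsClosedUnderLimitsOfShape WalkingCospan where
  limitsOfShape_le := by
    rintro Z ⟨h⟩
    have sq := IsPullback.of_isLimit_cone h.isLimit
    have hl := sq.map (Comma.fst _ _ ⋙ Scheme.Etale.forget Y ⋙ Over.forget Y)
    have hr := sq.map (Comma.snd _ _ ⋙ etalePullback f ⋙ Scheme.Etale.forget Y ⋙ Over.forget Y)
    have h₁ : IsFinite (h.diag.obj .left).hom.left := h.prop_diag_obj .left
    have h₂ : IsFinite (h.diag.obj .right).hom.left := h.prop_diag_obj .right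
    have h₃ : IsFinite (h.diag.obj .one).hom.left := h.prop_diag_obj .one
    have w {P Q : CovanishingCat f} (g : P ⟶ Q) :
        g.left.left ≫ Q.hom.left = P.hom.left ≫ ((etalePullback f).map g.right).left :=
      congr_arg (fun t => (Scheme.Etale.forget Y ⋙ Over.forget Y).map t) g.w
    exact @isFinite_of_isPullback _ _ _ _ _ _ _ _ _ _ _ _ hl _ _ _ _ hr _ _ _ _
      (w _) (w _) (w _) (w _) h₁ h₂ h₃

instance {X Y : Scheme.{u}} (f : Y ⟶ X) : (faltingsPrecoverage f).IsStableUnderBaseChange := by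
  unfold faltingsPrecoverage; infer_instance

instance {X Y : Scheme.{u}} (f : Y ⟶ X) : (covPrecoverage f).HasPullbacks where
  hasPullbacks_of_mem _ _ := inferInstance

instance {X Y : Scheme.{u}} (f : Y ⟶ X) : (faltingsPrecoverage f).HasPullbacks where
  hasPullbacks_of_mem _ _ := inferInstance

/-- `ρ⁺` is continuous. -/
instance {X Y : Scheme.{u}} (f : Y ⟶ X) :
    (rhoPlus f).IsContinuous (faltingsTopology f) (covTopology f) :=
  Functor.isContinuous_toGrothendieck_of_pullbacksPreservedBy _ _ _ le_rfl

/-- The Faltings topos of `f`: sheaves of sets on the Faltings site. -/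
abbrev FaltingsTopos {X Y : Scheme.{u}} (f : Y ⟶ X) := Sheaf (faltingsTopology f) (Type u)

/-- The co-vanishing topos of `f`: sheaves of sets on the co-vanishing site. -/
abbrev CovanishingTopos {X Y : Scheme.{u}} (f : Y ⟶ X) := Sheaf (covTopology f) (Type u)

/-- The direct image functor `ρ_*` from the co-vanishing topos to the Faltings topos,
`F ↦ F ∘ ρ⁺`. -/
noncomputable abbrev rhoDirectImage {X Y : Scheme.{u}} (f : Y ⟶ X) : CovanishingTopos f ⥤ FaltingsTopos f :=
  (rhoPlus f).sheafPushforwardContinuous (Type u) (faltingsTopology f) (covTopology f)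

/-- The pullback functor `ρ^*` from the Faltings topos to the co-vanishing topos, that is the left
adjoint of `ρ_*`. -/
noncomputable def rhoPullback {X Y : Scheme.{u}} (f : Y ⟶ X) [(rhoDirectImage f).IsRightAdjoint] :
    FaltingsTopos f ⥤ CovanishingTopos f :=
  (rhoDirectImage f).leftAdjoint

/-- A scheme `Y` is étale-locally connected if for every étale `Y' ⟶ Y`, the connected components of
`Y'` are open. -/
def IsEtaleLocallyConnected (Y : Scheme.{u}) : Prop :=
  ∀ (Y' : Scheme.{u}) (g : Y' ⟶ Y) [Etale g] (y : Y'), IsOpen (connectedComponent y)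

end Faltings

/-!
The functor `ρ^*` is fully faithful if and only if the unit `F ⟶ ρ_* ρ^* F` is an isomorphism for
every sheaf `F` on the Faltings site, that is, if and only if it is locally bijective. Here `ρ^* F`
is the sheafification of the left Kan extension of `F` along `ρ⁺`. The sites are large, so that the
existence of Kan extensions and sheafifications is not automatic; but the objects `V ⟶ U_Y` with `U`
affine and `V` quasi-compact form dense, essentially small subcategories of both sites, and the
Faltings site may be replaced by this subcategory. For `U` affine, a section of the Kan extension
over an étale `U_Y`-scheme `T` is a factorization `T ⟶ N ⟶ U_Y` through a finite étale `U_Y`-scheme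
`N` together with a section of `F` over `N`, up to common refinements (`exists_extElt_eq`,
`exists_of_extElt_eq`).

A covering of `V ⟶ U_Y`, with `U` affine and `V` quasi-compact, in the co-vanishing topology contains
vertical coverings after base change along an étale covering of `U` (`refinementSieve_mem`): the
vertical coverings involved have finite refinements by quasi-compact schemes, and so finitely many
coverings of `U` have to be intersected each time. Since the unit only has to be bijective locally,
this leaves a question over a fixed `U`, about the étale coverings of a finite étale `U_Y`-scheme `W`.

Consider a finite family `V i ⟶ W` which is an étale covering, with factorizations
`V i ⟶ Wᵢ i ⟶ W` through finite étale schemes and sections `s i` of `F` over the `Wᵢ i`, which are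
compatible étale-locally on the `V i ×[W] V j`. It is for these fibre products to be quasi-compact
that `Y` has to be quasi-separated. The locus where two sections of `F` over finite étale schemes
agree étale-locally is open. As the image of a finite étale scheme is also closed, this locus
contains every connected component which it meets (`isClopen_related`). Connected components being
open, it is open and closed. Hence the points of `Wᵢ i` at which `s i` agrees with the given data form
an open and closed subscheme `N i`, which is again finite étale over `W`, and through which `V i`
factors. The `N i` cover `W` in the finite étale topology and the sections `s i` agree on their
overlaps, so they glue to a section of `F` over `W` (`exists_descent`). This gives local surjectivity
of the unit (`isLocallySurjective_unit`); local injectivity (`isLocallyInjective_unit`) is easier and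
does not use connected components, because sections agreeing étale-locally do so on a covering by
finite étale schemes (`eq_of_related`).
-/

/-! ### Refinement of the coverings of the co-vanishing topology -/

namespace Covanishing

section Refinement

variable {A : Type u₁} [Category.{v₁} A] {B : Type u₂} [Category.{v₂} B] {F : A ⥤ B}

/-- A morphism of the comma category is cartesian if it exhibits `V'` as `V ×[F(U)] F(U')`. -/
def IsCart {Z' Z : Comma (𝟭 B) F} (c : Z' ⟶ Z) : Prop :=
  IsPullback c.left Z'.hom Z.hom (F.map c.right)

/-- The object `V' ⟶ U` deduced from `Z = (V ⟶ U)` and a morphism `t : V' ⟶ V`. -/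
abbrev vertObj (Z : Comma (𝟭 B) F) {V : B} (t : V ⟶ Z.left) : Comma (𝟭 B) F :=
  { left := V, right := Z.right, hom := t ≫ Z.hom }

/-- The vertical morphism `(V' ⟶ U) ⟶ (V ⟶ U)` given by `t : V' ⟶ V`. -/
abbrev vertHom (Z : Comma (𝟭 B) F) {V : B} (t : V ⟶ Z.left) : vertObj Z t ⟶ Z :=
  { left := t, right := 𝟙 _, w := by simp [vertObj] }

/-- The sieve of all `t : V' ⟶ V` such that the vertical morphism over `Z` given by `t` is in a
given sieve of `Z`. -/
def vertSieve {Z : Comma (𝟭 B) F} (S : Sieve Z) : Sieve Z.left where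
  arrows _ t := S (vertHom Z t)
  downward_closed {V V'} t ht t' := by
    have := S.downward_closed ht
      (show vertObj Z (t' ≫ t) ⟶ vertObj Z t from { left := t', right := 𝟙 _ })
    convert! this using 1
    ext <;> simp [vertHom]

lemma vertSieve_pullback {Z : Comma (𝟭 B) F} (S : Sieve Z) {V : B} (t : V ⟶ Z.left) :
    (vertSieve S).pullback t = vertSieve (S.pullback (vertHom Z t)) := by
  ext W w
  have h : vertHom Z (w ≫ t) = (show vertObj Z (w ≫ t) ⟶ vertObj (vertObj Z t) w from
      { left := 𝟙 W, right := 𝟙 Z.right }) ≫ vertHom (vertObj Z t) w ≫ vertHom Z t := by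
    ext <;> simp
  have h' : vertHom (vertObj Z t) w ≫ vertHom Z t =
      (show vertObj (vertObj Z t) w ⟶ vertObj Z (w ≫ t) from
      { left := 𝟙 W, right := 𝟙 Z.right }) ≫ vertHom Z (w ≫ t) := by
    ext <;> simp
  change S _ ↔ S _
  refine ⟨fun hw => ?_, fun hw => ?_⟩
  · rw [h']
    exact S.downward_closed hw _
  · rw [h]
    exact S.downward_closed hw _

lemma vertSieve_iff {Z : Comma (𝟭 B) F} (S : Sieve Z) {V : B} (t : V ⟶ Z.left) :
    vertSieve S t ↔ S (vertHom Z t) := Iff.rfl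

/-- The sieve of all `h : U' ⟶ U` such that every cartesian morphism over `Z` whose right component
factors through `h` has a given property. -/
def cartSieve {Z : Comma (𝟭 B) F} (p : ∀ ⦃Z' : Comma (𝟭 B) F⦄, (Z' ⟶ Z) → Prop) :
    Sieve Z.right where
  arrows U' h := ∀ ⦃Z' : Comma (𝟭 B) F⦄ (c : Z' ⟶ Z) (k : Z'.right ⟶ U'),
    IsCart c → c.right = k ≫ h → p c
  downward_closed {U' U''} h hh l Z' c k hc hk := hh c (k ≫ l) hc (by simp [hk])

/-- The base change of `Z` along `h : U' ⟶ U`. -/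
noncomputable abbrev cartObj [HasPullbacks B] (Z : Comma (𝟭 B) F) {U : A} (h : U ⟶ Z.right) :
    Comma (𝟭 B) F :=
  { left := pullback Z.hom (F.map h), right := U, hom := pullback.snd Z.hom (F.map h) }

/-- The cartesian morphism from the base change of `Z` along `h` to `Z`. -/
noncomputable abbrev cartHom [HasPullbacks B] (Z : Comma (𝟭 B) F) {U : A} (h : U ⟶ Z.right) :
    cartObj Z h ⟶ Z :=
  { left := pullback.fst Z.hom (F.map h), right := h, w := pullback.condition }

lemma isCart_cartHom [HasPullbacks B] (Z : Comma (𝟭 B) F) {U : A} (h : U ⟶ Z.right) :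
    IsCart (cartHom Z h) :=
  IsPullback.of_hasPullback Z.hom (F.map h)

/-- A cartesian morphism `c` is terminal among morphisms whose right component factors through
that of `c`. -/
noncomputable def IsCart.lift {Z' Z W : Comma (𝟭 B) F} {c : Z' ⟶ Z} (hc : IsCart c) (g : W ⟶ Z)
    (k : W.right ⟶ Z'.right) (hk : k ≫ c.right = g.right) : W ⟶ Z' where
  left := IsPullback.lift hc g.left (W.hom ≫ F.map k) (by
    have := g.w
    simp only [Functor.id_map] at this
    rw [this, Category.assoc, ← F.map_comp, hk])
  right := k
  w := by
    simpa using! hc.lift_snd _ _ _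

@[simp]
lemma IsCart.lift_comp {Z' Z W : Comma (𝟭 B) F} {c : Z' ⟶ Z} (hc : IsCart c) (g : W ⟶ Z)
    (k : W.right ⟶ Z'.right) (hk : k ≫ c.right = g.right) : hc.lift g k hk ≫ c = g := by
  ext
  · exact hc.lift_fst _ _ _
  · exact hk

lemma IsCart.comp {Z'' Z' Z : Comma (𝟭 B) F} {c : Z' ⟶ Z} {d : Z'' ⟶ Z'} (hc : IsCart c)
    (hd : IsCart d) : IsCart (d ≫ c) := by
  have := IsPullback.paste_horiz hd hc
  simpa [IsCart] using this

/-- The cancellation property of fibre product squares. -/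
lemma IsCart.of_comp {Z'' Z' Z : Comma (𝟭 B) F} {c : Z' ⟶ Z} {d : Z'' ⟶ Z'} (hc : IsCart c)
    (hdc : IsCart (d ≫ c)) : IsCart d := by
  have h : IsPullback (d ≫ c).left Z''.hom Z.hom (F.map (d ≫ c).right) := hdc
  have e : (d ≫ c).left = d.left ≫ c.left := rfl
  have e' : F.map (d ≫ c).right = F.map d.right ≫ F.map c.right := by simp
  rw [e, e'] at h
  exact IsPullback.of_right h d.w hc

/-- Vertical morphisms pull back along cartesian morphisms. -/
lemma IsCart.exists_vert_pullback [HasPullbacks B] {Z' Z : Comma (𝟭 B) F} {c : Z' ⟶ Z}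
    (hc : IsCart c) {V : B} (t : V ⟶ Z.left) :
    ∃ d : vertObj Z' (pullback.snd t c.left) ⟶ vertObj Z t, IsCart d ∧ d.right = c.right ∧
      d ≫ vertHom Z t = vertHom Z' (pullback.snd t c.left) ≫ c := by
  have hp := (IsPullback.of_hasPullback t c.left).flip
  have hh := hp.flip.paste_vert hc
  refine ⟨{ left := pullback.fst t c.left, right := c.right, w := hh.w }, hh, rfl, ?_⟩
  ext
  · exact pullback.condition
  · simp

variable (J : GrothendieckTopology A) (K : GrothendieckTopology B)

/-- The sieve of all `h : U' ⟶ U` such that, after base change along `h`, a given sieve of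
`Z = (V ⟶ U)` contains a vertical covering. -/
abbrev refinementSieve {Z : Comma (𝟭 B) F} (S : Sieve Z) : Sieve Z.right :=
  cartSieve fun Z' c => vertSieve (S.pullback c) ∈ K Z'.left

variable {J K}

lemma vertSieve_pullback_mem_of_isVertical {Z Z' : Comma (𝟭 B) F} {R : Presieve Z}
    (hR : IsVertical K R) (g : Z' ⟶ Z) :
    vertSieve ((Sieve.generate R).pullback g) ∈ K Z'.left := by
  refine K.superset_covering ?_ (K.pullback_stable g.left hR.covering_left)
  rintro V t ⟨_, a, _, hr', ha⟩
  obtain @⟨W, r, hr⟩ := hr'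
  have := hR.isIso_right r hr
  refine ⟨W, { left := a, right := g.right ≫ inv r.right, w := ?_ }, r, hr, ?_⟩
  · have h1 := r.w
    have h2 := g.w
    simp only [Functor.id_map, Functor.id_obj] at h1 h2
    rw [← cancel_mono (F.map r.right)]
    change a ≫ r.left = t ≫ g.left at ha
    simp only [Functor.id_map, Category.assoc, ← h1, reassoc_of% ha, h2, ← F.map_comp,
      IsIso.inv_hom_id, Category.comp_id]
  · ext
    · exact ha
    · simp

lemma vertSieve_top (Z : Comma (𝟭 B) F) : vertSieve (⊤ : Sieve Z) = ⊤ := by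
  ext; simp [vertSieve_iff]

lemma refinementSieve_mem_of_isCartesian {Z Z' : Comma (𝟭 B) F} {R : Presieve Z}
    (hR : IsCartesian J R) (g : Z' ⟶ Z) :
    refinementSieve K ((Sieve.generate R).pullback g) ∈ J Z'.right := by
  refine J.superset_covering ?_ (J.pullback_stable g.right hR.covering_right)
  rintro U h ⟨_, a, _, hr', ha⟩ Z'' c k hc hk
  obtain @⟨W, r, hr⟩ := hr'
  have hrc : IsCart r := hR.isPullback r hr
  change a ≫ r.right = h ≫ g.right at ha
  have : ((Sieve.generate R).pullback g).pullback c = ⊤ := by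
    rw [← Sieve.pullback_comp, ← Sieve.mem_iff_pullback_eq_top]
    exact ⟨W, hrc.lift (c ≫ g) (k ≫ a) (by simp [ha, hk]), r, hr, hrc.lift_comp _ _ _⟩
  rw [this, vertSieve_top]
  exact K.top_mem _

/-- A finiteness condition on the sites `(A, J)`, `(B, K)`: any object of `A` is covered by objects
satisfying `a`, any covering of an object satisfying `b` has a finite refinement by objects
satisfying `b`, and the base change of an object satisfying `b` along the image under `F` of a
morphism of objects satisfying `a` satisfies `b`. -/
structure IsFinitary [HasPullbacks B] (F : A ⥤ B) (J : GrothendieckTopology A)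
    (K : GrothendieckTopology B) (a : ObjectProperty A) (b : ObjectProperty B) : Prop where
  dense : ∀ (U : A) (S : Sieve U), (∀ ⦃U' : A⦄ (h : U' ⟶ U), a U' → S h) → S ∈ J U
  finite : ∀ (V : B) (S : Sieve V), b V → S ∈ K V → ∃ (n : ℕ) (W : Fin n → B) (t : ∀ i, W i ⟶ V),
    (∀ i, b (W i)) ∧ (∀ i, S (t i)) ∧ Sieve.ofArrows W t ∈ K V
  baseChange : ∀ ⦃U U' : A⦄ ⦃V : B⦄ (h : U' ⟶ U) (v : V ⟶ F.obj U), a U → a U' → b V →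
    b (pullback v (F.map h))

/-- A sieve is covering if it is covering after base change to the objects satisfying `a` over some
covering. -/
lemma IsFinitary.mem_of_forall [HasPullbacks B] {a : ObjectProperty A} {b : ObjectProperty B}
    (H : IsFinitary F J K a b) {U : A} {R S : Sieve U} (hR : R ∈ J U)
    (h : ∀ ⦃U' : A⦄ (k : U' ⟶ U), a U' → R k → S.pullback k ∈ J U') : S ∈ J U := by
  refine J.transitive hR _ fun U' k hk => ?_
  let R' : Sieve U' := Sieve.generate (fun U'' l => a U'')
  have hR' : R' ∈ J U' := H.dense _ _ fun U'' l hl => Sieve.le_generate _ _ _ hl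
  refine J.transitive hR' _ ?_
  rintro U'' _ ⟨W, x, y, hy, rfl⟩
  rw [Sieve.pullback_comp]
  refine J.pullback_stable _ ?_
  rw [← Sieve.pullback_comp]
  exact h _ hy (R.downward_closed hk _)

lemma finite_iInf_mem {C : Type*} [Category* C] (J : GrothendieckTopology C) {X : C} {n : ℕ}
    (S : Fin n → Sieve X) (h : ∀ i, S i ∈ J X) : (⨅ i, S i) ∈ J X := by
  induction n with
  | zero => simpa only [iInf_of_empty] using J.top_mem X
  | succ n ih =>
    refine J.superset_covering ?_ (J.intersection_covering (h 0) (ih (fun i => S i.succ)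
      fun i => h _))
    refine le_iInf fun i => ?_
    refine Fin.cases inf_le_left (fun j => inf_le_right.trans (iInf_le _ j)) i

/-- The transitivity step of `refinementSieve_mem`. This is where finiteness matters: once a vertical
covering of the base change of `Z` is given, each of its members yields its own covering of the base,
and only finitely many of these can be intersected. -/
lemma refinementSieve_mem_of_transitive [HasPullbacks B] {a : ObjectProperty A}
    {b : ObjectProperty B} (H : IsFinitary F J K a b) {Z : Comma (𝟭 B) F} (hr : a Z.right)
    (hl : b Z.left) {S T : Sieve Z} (hS : refinementSieve K S ∈ J Z.right)
    (hT : ∀ ⦃Z' : Comma (𝟭 B) F⦄ (g : Z' ⟶ Z), S g → a Z'.right → b Z'.left →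
      refinementSieve K (T.pullback g) ∈ J Z'.right) :
    refinementSieve K T ∈ J Z.right := by
  refine H.mem_of_forall hS fun U' h hU' hh => ?_
  let Z' := cartObj Z h
  let c : Z' ⟶ Z := cartHom Z h
  have hc : IsCart c := isCart_cartHom Z h
  have hcov : vertSieve (S.pullback c) ∈ K Z'.left := hh c (𝟙 _) hc (Category.id_comp _).symm
  obtain ⟨n, V, t, hV, ht, htK⟩ := H.finite _ _ (H.baseChange h Z.hom hr hU' hl) hcov
  have hR (i : Fin n) := hT (vertHom Z' (t i) ≫ c) (ht i) hU' (hV i)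
  refine J.superset_covering ?_ (finite_iInf_mem J _ hR)
  intro U'' k hk Z'' c'' l hc'' hl''
  obtain ⟨e, hec, her⟩ : ∃ e : Z'' ⟶ Z', e ≫ c = c'' ∧ e.right = l ≫ k :=
    ⟨hc.lift c'' (l ≫ k) (by simp [hl'', c]), hc.lift_comp _ _ _, rfl⟩
  have he : IsCart e := IsCart.of_comp hc (by rwa [hec])
  let R := Sieve.ofArrows (fun i => pullback (t i) e.left) (fun i => pullback.snd (t i) e.left)
  have hRK : R ∈ K Z''.left := by
    refine K.superset_covering ?_ (K.pullback_stable e.left htK)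
    rintro W w ⟨_, x, _, ⟨i⟩, hx⟩
    exact ⟨_, pullback.lift x w hx, _, ⟨i⟩, pullback.lift_snd _ _ _⟩
  refine K.transitive hRK _ ?_
  rintro W _ ⟨_, x, _, ⟨i⟩, rfl⟩
  rw [Sieve.pullback_comp]
  refine K.pullback_stable _ ?_
  obtain ⟨d, hd, hdr, hdc⟩ := he.exists_vert_pullback (t i)
  have hki : refinementSieve K (T.pullback (vertHom Z' (t i) ≫ c)) k := by
    have hle := iInf_le (α := Sieve U')
      (fun i => refinementSieve K (T.pullback (vertHom Z' (t i) ≫ c))) i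
    exact hle _ hk
  have := hki d l hd (hdr.trans her)
  rw [vertSieve_pullback, ← Sieve.pullback_comp, ← hec, ← Category.assoc, ← hdc, Category.assoc,
    Sieve.pullback_comp]
  exact this

/-- Every covering of the co-vanishing topology is refined by a composition of a cartesian
covering and of vertical coverings. The statement is proved together with all its base changes, by
induction on the generation of the topology. -/
theorem refinementSieve_mem [HasPullbacks B] {a : ObjectProperty A} {b : ObjectProperty B}
    (H : IsFinitary F J K a b) {Z : Comma (𝟭 B) F} (hr : a Z.right) (hl : b Z.left)
    {S : Sieve Z} (hS : S ∈ (precoverage F J K).toGrothendieck Z) :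
    refinementSieve K S ∈ J Z.right := by
  suffices ∀ ⦃Z' : Comma (𝟭 B) F⦄ (g : Z' ⟶ Z), a Z'.right → b Z'.left →
      refinementSieve K (S.pullback g) ∈ J Z'.right by
    simpa using this (𝟙 Z) hr hl
  clear hr hl
  rw [Precoverage.mem_toGrothendieck_iff] at hS
  induction hS with
  | of Z R hR =>
    intro Z' g _ _
    rcases hR with hR | hR
    · convert! J.top_mem Z'.right
      rw [eq_top_iff]
      intro U h _ Z'' c k hc hk
      simpa only [← Sieve.pullback_comp] using vertSieve_pullback_mem_of_isVertical hR (c ≫ g)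
    · exact refinementSieve_mem_of_isCartesian hR g
  | top Z =>
    intro Z' g _ _
    convert! J.top_mem Z'.right
    rw [eq_top_iff]
    intro U h _ Z'' c k hc hk
    simp [vertSieve_top]
  | pullback Z S _ Z' f ih =>
    intro Z'' g ha hb
    rw [← Sieve.pullback_comp]
    exact ih _ ha hb
  | transitive Z S R _ _ ih ih' =>
    intro Z' g ha hb
    refine refinementSieve_mem_of_transitive H ha hb (ih g ha hb) fun Z'' g' hg' ha' hb' => ?_
    have := ih' hg' (𝟙 _) ha' hb'
    rwa [Sieve.pullback_id, Sieve.pullback_comp] at this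

end Refinement

end Covanishing

/-! ### Descent of sections along étale coverings of finite étale schemes -/

namespace Faltings

open Opposite

section Descent

lemma exists_preimage_of_isPullback {P X X' Z : Scheme.{u}} {p : P ⟶ X} {q : P ⟶ X'} {a : X ⟶ Z}
    {b : X' ⟶ Z} (h : IsPullback p q a b) (x : X) (x' : X') (hx : a x = b x') :
    ∃ z : P, p z = x ∧ q z = x' := by
  obtain ⟨z, hz, hz'⟩ := Scheme.Pullback.exists_preimage_pullback x x' hx
  refine ⟨h.isoPullback.inv z, ?_, ?_⟩
  · rw [← hz, ← Scheme.Hom.comp_apply, h.isoPullback_inv_fst]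
  · rw [← hz', ← Scheme.Hom.comp_apply, h.isoPullback_inv_snd]

variable {Y : Scheme.{u}} {S : Y.Etale}

/-- The underlying scheme of an étale scheme over `S`. -/
noncomputable abbrev overScheme (S : Y.Etale) : Over S ⥤ Scheme.{u} :=
  Over.forget S ⋙ Scheme.Etale.forget Y ⋙ Over.forget Y

variable (S) in
/-- The finite étale `S`-schemes. Being étale over `S` is automatic here, since the objects and the
morphisms of `Y.Etale` are étale. -/
def finObj : ObjectProperty (Over S) := fun T => IsFinite T.hom.left

lemma exists_preimage_over {P T T' Z : Over S} {p : P ⟶ T} {q : P ⟶ T'} {a : T ⟶ Z} {b : T' ⟶ Z}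
    (h : IsPullback p q a b) (x : T.left.left) (x' : T'.left.left)
    (hx : a.left.left x = b.left.left x') :
    ∃ z : P.left.left, p.left.left z = x ∧ q.left.left z = x' :=
  exists_preimage_of_isPullback (h.map (overScheme S)) x x' hx

lemma over_comp_apply {T T' T'' : Over S} (g : T ⟶ T') (h : T' ⟶ T'') (x : T.left.left) :
    (g ≫ h).left.left x = h.left.left (g.left.left x) := rfl

lemma isOpenMap_over {T T' : Over S} (g : T ⟶ T') : IsOpenMap g.left.left :=
  g.left.left.isOpenMap

lemma over_left_w {T T' : Over S} (g : T ⟶ T') : g.left.left ≫ T'.hom.left = T.hom.left :=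
  congr_arg (fun t => (Scheme.Etale.forget Y ⋙ Over.forget Y).map t) (Over.w g)

lemma isFinite_over {T T' : Over S} (g : T ⟶ T') (hT : finObj S T) (hT' : finObj S T') :
    IsFinite g.left.left := by
  have h1 : IsFinite T.hom.left := hT
  have h2 : IsFinite T'.hom.left := hT'
  have : IsFinite (g.left.left ≫ T'.hom.left) := by rwa [over_left_w]
  exact IsFinite.of_comp g.left.left T'.hom.left

lemma finObj_of_isFinite {T T' : Over S} (g : T ⟶ T') [IsFinite g.left.left] (hT' : finObj S T') :
    finObj S T := by
  have h2 : IsFinite T'.hom.left := hT'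
  change IsFinite T.hom.left
  rw [← over_left_w g]
  infer_instance

lemma isFinite_of_isPullback_over {P T T' Z : Over S} {p : P ⟶ T} {q : P ⟶ T'} {a : T ⟶ Z}
    {b : T' ⟶ Z} (h : IsPullback p q a b) [IsFinite b.left.left] : IsFinite p.left.left :=
  MorphismProperty.of_isPullback (P := @IsFinite) (h.map (overScheme S)).flip ‹_›

lemma finObj_of_isPullback {P T T' Z : Over S} {p : P ⟶ T} {q : P ⟶ T'} {a : T ⟶ Z}
    {b : T' ⟶ Z} (h : IsPullback p q a b) (hT : finObj S T) (hT' : finObj S T')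
    (hZ : finObj S Z) : finObj S P := by
  have := isFinite_over b hT' hZ
  have := isFinite_of_isPullback_over h
  exact finObj_of_isFinite p hT

/-- The fibre product of `T` and `Q` over `W ×[S] W'`, for `Q`, `W` and `W'` finite over `S`. It is
finite over `T`. -/
lemma exists_finite_pullback {W W' Q : Over S} (hW : finObj S W) (hW' : finObj S W')
    (hQ : finObj S Q) {T : Over S} (a : T ⟶ W) (b : T ⟶ W') (α : Q ⟶ W) (β : Q ⟶ W') :
    ∃ (P : Over S) (p : P ⟶ T) (r : P ⟶ Q), IsFinite p.left.left ∧ r ≫ α = p ≫ a ∧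
      r ≫ β = p ≫ b ∧ ∀ ⦃T' : Over S⦄ (g : T' ⟶ T) (q : T' ⟶ Q), q ≫ α = g ≫ a →
        q ≫ β = g ≫ b → ∃ l : T' ⟶ P, l ≫ p = g := by
  obtain ⟨M, f₁, f₂, hM⟩ : ∃ (M : Over S) (f₁ : M ⟶ W) (f₂ : M ⟶ W'),
      IsPullback f₁ f₂ (Over.mkIdTerminal.from W) (Over.mkIdTerminal.from W') :=
    ⟨_, _, _, IsPullback.of_hasPullback _ _⟩
  have hS : finObj S (Over.mk (𝟙 S)) := inferInstanceAs (IsFinite (𝟙 S.left))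
  obtain ⟨m, hm₁, hm₂⟩ : ∃ m : T ⟶ M, m ≫ f₁ = a ∧ m ≫ f₂ = b :=
    ⟨hM.lift a b (Over.mkIdTerminal.hom_ext _ _), hM.lift_fst _ _ _, hM.lift_snd _ _ _⟩
  obtain ⟨r, hr₁, hr₂⟩ : ∃ r : Q ⟶ M, r ≫ f₁ = α ∧ r ≫ f₂ = β :=
    ⟨hM.lift α β (Over.mkIdTerminal.hom_ext _ _), hM.lift_fst _ _ _, hM.lift_snd _ _ _⟩
  have := isFinite_over r hQ (finObj_of_isPullback hM hW hW' hS)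
  have sq := IsPullback.of_hasPullback m r
  refine ⟨_, pullback.fst m r, pullback.snd m r, isFinite_of_isPullback_over sq, ?_, ?_, ?_⟩
  · rw [← hr₁, ← hm₁, pullback.condition_assoc]
  · rw [← hr₂, ← hm₂, pullback.condition_assoc]
  · intro T' g q h₁ h₂
    refine ⟨pullback.lift g q (hM.hom_ext ?_ ?_), pullback.lift_fst _ _ _⟩
    · rw [Category.assoc, Category.assoc, hr₁, hm₁, h₁]
    · rw [Category.assoc, Category.assoc, hr₂, hm₂, h₂]

/-- An open and closed subset of a finite étale `S`-scheme, as a finite étale `S`-scheme. -/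
lemma exists_clopen_subobject {W : Over S} (hW : finObj S W) {C : Set W.left.left}
    (hC : IsClopen C) : ∃ (N : (finObj S).FullSubcategory) (n : N.obj ⟶ W),
      (∀ x, n.left.left x ∈ C) ∧ (∀ x ∈ C, ∃ y, n.left.left y = x) ∧
      ∀ ⦃T : Over S⦄ (g : T ⟶ W), (∀ t, g.left.left t ∈ C) → ∃ q : T ⟶ N.obj, q ≫ n = g := by
  let U : W.left.left.Opens := ⟨C, hC.isOpen⟩
  let N₀ : Y.Etale := MorphismProperty.Over.mk ⊤ (U.ι ≫ W.left.hom) (inferInstanceAs (Etale _))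
  let n₀ : N₀ ⟶ W.left := MorphismProperty.Over.homMk U.ι rfl trivial
  let n : Over.mk (n₀ ≫ W.hom) ⟶ W := Over.homMk n₀ rfl
  have hcl : IsClosedImmersion U.ι := by
    refine IsClosedImmersion.of_isPreimmersion _ ?_
    rw [Scheme.Opens.range_ι]
    exact hC.isClosed
  have hfin : IsFinite n.left.left := inferInstanceAs (IsFinite U.ι)
  refine ⟨⟨_, finObj_of_isFinite n hW⟩, n, fun x => ?_, fun x hx => ⟨⟨x, hx⟩, rfl⟩, ?_⟩
  · exact Subtype.property (p := (· ∈ C)) x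
  · intro T g hg
    have hr : Set.range g.left.left ⊆ Set.range U.ι := by
      rw [Scheme.Opens.range_ι]
      rintro _ ⟨t, rfl⟩
      exact hg t
    let l := IsOpenImmersion.lift U.ι g.left.left hr
    have hl : l ≫ U.ι = g.left.left := IsOpenImmersion.lift_fac _ _ _
    let q₀ : T.left ⟶ N₀ := MorphismProperty.Over.homMk l (by
      change l ≫ U.ι ≫ W.left.hom = _
      rw [reassoc_of% hl]
      exact CategoryTheory.Over.w ((Scheme.Etale.forget Y).map g.left)) trivial
    have hq : q₀ ≫ n₀ = g.left := by
      apply (Scheme.Etale.forget Y ⋙ Over.forget Y).map_injective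
      exact hl
    refine ⟨Over.homMk q₀ ?_, ?_⟩
    · change q₀ ≫ n₀ ≫ W.hom = T.hom
      rw [← Category.assoc, hq, Over.w]
    · ext1
      exact hq

variable (Φ : (finObj S).FullSubcategoryᵒᵖ ⥤ Type u)

/-- Let `s`, `s'` be sections of `Φ` over finite étale `S`-schemes `W`, `W'`. The sections `s` and
`s'` are related at a point `t` of an étale `S`-scheme `T` endowed with morphisms to `W` and `W'`
if, in an étale neighbourhood of `t`, these morphisms factor through a finite étale `S`-scheme
over which `s` and `s'` have the same pullback. -/
def Related {W W' : (finObj S).FullSubcategory} (s : Φ.obj (op W)) (s' : Φ.obj (op W'))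
    {T : Over S} (a : T ⟶ W.obj) (b : T ⟶ W'.obj) (t : T.left.left) : Prop :=
  ∃ (Q : (finObj S).FullSubcategory) (α : Q ⟶ W) (β : Q ⟶ W') (T' : Over S) (g : T' ⟶ T)
    (q : T' ⟶ Q.obj) (t' : T'.left.left), g.left.left t' = t ∧
    Φ.map α.op s = Φ.map β.op s' ∧ q ≫ α.hom = g ≫ a ∧ q ≫ β.hom = g ≫ b

variable {Φ} {W W' W'' : (finObj S).FullSubcategory} {s : Φ.obj (op W)} {s' : Φ.obj (op W')}
  {s'' : Φ.obj (op W'')} {T T' : Over S} {a : T ⟶ W.obj} {b : T ⟶ W'.obj} {c : T ⟶ W''.obj}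
  {t : T.left.left}

lemma Related.of_eq {Q : (finObj S).FullSubcategory} {α : Q ⟶ W} {β : Q ⟶ W'}
    (h : Φ.map α.op s = Φ.map β.op s') (q : T ⟶ Q.obj) (ha : q ≫ α.hom = a) (hb : q ≫ β.hom = b)
    (t : T.left.left) : Related Φ s s' a b t :=
  ⟨Q, α, β, T, 𝟙 _, q, t, rfl, h, by simpa, by simpa⟩

lemma Related.refl (s : Φ.obj (op W)) (a : T ⟶ W.obj) (t : T.left.left) : Related Φ s s a a t :=
  .of_eq (α := 𝟙 W) (β := 𝟙 W) rfl a (by simp) (by simp) t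

lemma Related.symm (h : Related Φ s s' a b t) : Related Φ s' s b a t := by
  obtain ⟨Q, α, β, T', g, q, t', h1, h2, h3, h4⟩ := h
  exact ⟨Q, β, α, T', g, q, t', h1, h2.symm, h4, h3⟩

lemma related_precomp_iff (g : T' ⟶ T) (t' : T'.left.left) :
    Related Φ s s' (g ≫ a) (g ≫ b) t' ↔ Related Φ s s' a b (g.left.left t') := by
  constructor
  · rintro ⟨Q, α, β, T'', g', q, t'', h1, h2, h3, h4⟩
    exact ⟨Q, α, β, T'', g' ≫ g, q, t'', by rw [over_comp_apply, h1], h2, by simpa using h3,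
      by simpa using h4⟩
  · rintro ⟨Q, α, β, T'', g', q, t'', h1, h2, h3, h4⟩
    have sq := IsPullback.of_hasPullback g g'
    obtain ⟨z, hz, hz'⟩ := exists_preimage_over sq t' t'' h1.symm
    refine ⟨Q, α, β, _, pullback.fst g g', pullback.snd g g' ≫ q, z, hz, h2, ?_, ?_⟩
    · rw [Category.assoc, h3, pullback.condition_assoc]
    · rw [Category.assoc, h4, pullback.condition_assoc]

lemma Related.trans (h : Related Φ s s' a b t) (h' : Related Φ s' s'' b c t) :
    Related Φ s s'' a c t := by
  obtain ⟨Q, α, β, T₁, g, q, t₁, h1, h2, h3, h4⟩ := h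
  obtain ⟨Q', α', β', T₂, g', q', t₂, h1', h2', h3', h4'⟩ := h'
  obtain ⟨z, hz, hz'⟩ := exists_preimage_over (IsPullback.of_hasPullback g g') t₁ t₂
    (h1.trans h1'.symm)
  let P : (finObj S).FullSubcategory := ⟨pullback β.hom α'.hom,
    finObj_of_isPullback (IsPullback.of_hasPullback _ _) Q.property Q'.property W'.property⟩
  let p : P ⟶ Q := ObjectProperty.homMk (pullback.fst β.hom α'.hom)
  let p' : P ⟶ Q' := ObjectProperty.homMk (pullback.snd β.hom α'.hom)
  have hp : p ≫ β = p' ≫ α' := by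
    ext1
    exact pullback.condition
  refine ⟨P, p ≫ α, p' ≫ β', pullback g g', pullback.fst g g' ≫ g,
    pullback.lift (pullback.fst g g' ≫ q) (pullback.snd g g' ≫ q')
      (by rw [Category.assoc, Category.assoc, h4, h3', pullback.condition_assoc]), z, ?_, ?_, ?_, ?_⟩
  · rw [over_comp_apply, hz, h1]
  · rw [op_comp, op_comp, Φ.map_comp, Φ.map_comp, types_comp_apply, types_comp_apply, h2, ← h2',
      ← types_comp_apply, ← types_comp_apply, ← Φ.map_comp, ← Φ.map_comp, ← op_comp, ← op_comp, hp]
  · change _ ≫ pullback.fst β.hom α'.hom ≫ α.hom = _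
    rw [pullback.lift_fst_assoc, Category.assoc, h3, Category.assoc]
  · change _ ≫ pullback.snd β.hom α'.hom ≫ β'.hom = _
    rw [pullback.lift_snd_assoc, Category.assoc, h4', Category.assoc, pullback.condition_assoc (f := g)]

lemma isOpen_related (a : T ⟶ W.obj) (b : T ⟶ W'.obj) : IsOpen {t | Related Φ s s' a b t} := by
  rw [isOpen_iff_forall_mem_open]
  rintro t ⟨Q, α, β, T', g, q, t', h1, h2, h3, h4⟩
  refine ⟨Set.range g.left.left, ?_, (isOpenMap_over g).isOpen_range, ⟨t', h1⟩⟩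
  rintro _ ⟨t'', rfl⟩
  exact ⟨Q, α, β, T', g, q, t'', rfl, h2, h3, h4⟩

variable (hY : IsEtaleLocallyConnected Y)

include hY in
/-- The locus where two sections are related is closed: if it meets the connected component of a
point `t₀`, at a point where the sections agree on the finite étale scheme `Q`, then the image of the
fibre product of `T` and `Q` is open and closed, and so contains the whole component. -/
lemma isClopen_related (a : T ⟶ W.obj) (b : T ⟶ W'.obj) : IsClopen {t | Related Φ s s' a b t} := by
  refine ⟨⟨?_⟩, isOpen_related a b⟩
  rw [isOpen_iff_forall_mem_open]
  intro t₀ ht₀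
  have hC : IsClopen (connectedComponent t₀) :=
    ⟨isClosed_connectedComponent, hY T.left.left T.left.hom t₀⟩
  refine ⟨_, ?_, hC.isOpen, mem_connectedComponent⟩
  rintro t₁ ht₁ ⟨Q, α, β, T', g, q, t', h1, h2, h3, h4⟩
  apply ht₀
  obtain ⟨P, p, r, hp, hα, hβ, hl⟩ :=
    exists_finite_pullback W.property W'.property Q.property a b α.hom β.hom
  have hr : IsClopen (Set.range p.left.left) :=
    ⟨p.left.left.isClosedMap.isClosed_range, (isOpenMap_over _).isOpen_range⟩
  obtain ⟨l, rfl⟩ := hl g q h3 h4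
  have ht₁' : t₁ ∈ Set.range p.left.left := ⟨l.left.left t', h1⟩
  obtain ⟨z, hz⟩ := isPreconnected_connectedComponent.subset_isClopen hr ⟨t₁, ht₁, ht₁'⟩
    (mem_connectedComponent (x := t₀))
  exact ⟨Q, α, β, P, p, r, z, hz, h2, hα, hβ⟩

variable (hΦ : ∀ (W : (finObj S).FullSubcategory) (R : Presieve W),
  (∀ w : W.obj.left.left, ∃ (N : (finObj S).FullSubcategory) (n : N ⟶ W) (x : N.obj.left.left),
    R n ∧ n.hom.left.left x = w) → R.IsSheafFor Φ)

include hΦ in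
/-- Sections which are related at every point of a finite étale scheme agree there. -/
lemma eq_of_related {Z : (finObj S).FullSubcategory} {a : Z ⟶ W} {b : Z ⟶ W'}
    (h : ∀ t, Related Φ s s' a.hom b.hom t) : Φ.map a.op s = Φ.map b.op s' := by
  refine (hΦ Z (fun N n => Φ.map n.op (Φ.map a.op s) = Φ.map n.op (Φ.map b.op s'))
    fun t => ?_).isSeparatedFor.ext fun N n hn => hn
  obtain ⟨Q, α, β, T', g, q, t', h1, h2, h3, h4⟩ := h t
  obtain ⟨P, p, r, hp, hα, hβ, hl⟩ :=
    exists_finite_pullback W.property W'.property Q.property a.hom b.hom α.hom β.hom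
  obtain ⟨l, rfl⟩ := hl g q h3 h4
  let N : (finObj S).FullSubcategory := ⟨P, finObj_of_isFinite p Z.property⟩
  let n : N ⟶ Z := ObjectProperty.homMk p
  let n' : N ⟶ Q := ObjectProperty.homMk r
  have e1 : n ≫ a = n' ≫ α := by ext1; exact hα.symm
  have e2 : n ≫ b = n' ≫ β := by ext1; exact hβ.symm
  refine ⟨N, n, l.left.left t', ?_, h1⟩
  change Φ.map n.op (Φ.map a.op s) = Φ.map n.op (Φ.map b.op s')
  rw [← types_comp_apply, ← types_comp_apply, ← Φ.map_comp, ← Φ.map_comp, ← op_comp, ← op_comp,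
    e1, e2, op_comp, op_comp, Φ.map_comp, Φ.map_comp, types_comp_apply, types_comp_apply, h2]

include hY hΦ in
/-- Descent of sections of `Φ` along an étale covering `(V i)` of `W`, if the `V i` are endowed
with morphisms to finite étale schemes `Wᵢ` over `W` and with sections of `Φ` over the `Wᵢ` that
are related on the `V i ×[W] V j`. -/
theorem exists_descent {ι : Type*} {W : (finObj S).FullSubcategory}
    {Wᵢ : ι → (finObj S).FullSubcategory} (π : ∀ i, Wᵢ i ⟶ W) (s : ∀ i, Φ.obj (op (Wᵢ i)))
    {V : ι → Over S} (φ : ∀ i, V i ⟶ (Wᵢ i).obj)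
    (hV : ∀ w : W.obj.left.left, ∃ (i : ι) (v : (V i).left.left),
      (φ i ≫ (π i).hom).left.left v = w)
    (hrel : ∀ (i j : ι) ⦃T : Over S⦄ (a : T ⟶ V i) (b : T ⟶ V j),
      a ≫ φ i ≫ (π i).hom = b ≫ φ j ≫ (π j).hom →
      ∀ t, Related Φ (s i) (s j) (a ≫ φ i) (b ≫ φ j) t) :
    ∃ x : Φ.obj (op W), ∀ i, ∃ (N : (finObj S).FullSubcategory) (n : N ⟶ Wᵢ i) (q : V i ⟶ N.obj),
      q ≫ n.hom = φ i ∧ Φ.map (n ≫ π i).op x = Φ.map n.op (s i) := by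
  -- the points of `Wᵢ i` at which `s i` agrees with the given data
  let C (i : ι) : Set (Wᵢ i).obj.left.left := {w | ∃ (j : ι) (T : Over S) (a : T ⟶ (Wᵢ i).obj)
    (b : T ⟶ V j) (t : T.left.left), a ≫ (π i).hom = b ≫ φ j ≫ (π j).hom ∧ a.left.left t = w ∧
    Related Φ (s i) (s j) a (b ≫ φ j) t}
  -- membership in `C i` can be tested with any index `j` and any `T`
  have hC {i j : ι} {T : Over S} (a : T ⟶ (Wᵢ i).obj) (b : T ⟶ V j)
      (hab : a ≫ (π i).hom = b ≫ φ j ≫ (π j).hom) (t : T.left.left) :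
      a.left.left t ∈ C i ↔ Related Φ (s i) (s j) a (b ≫ φ j) t := by
    refine ⟨?_, fun h => ⟨j, T, a, b, t, hab, rfl, h⟩⟩
    rintro ⟨j', T', a', b', t', hab', ht', h⟩
    obtain ⟨z, rfl, rfl⟩ := exists_preimage_over (IsPullback.of_hasPullback a a') t t' ht'.symm
    rw [← related_precomp_iff] at h ⊢
    rw [← pullback.condition, ← Category.assoc] at h
    rw [← Category.assoc]
    refine h.trans (hrel j' j _ _ ?_ z)
    rw [Category.assoc, Category.assoc, ← hab, ← hab', pullback.condition_assoc]
  have hex (i : ι) (w : (Wᵢ i).obj.left.left) : ∃ (j : ι) (T : Over S) (a : T ⟶ (Wᵢ i).obj)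
      (b : T ⟶ V j) (t : T.left.left), a ≫ (π i).hom = b ≫ φ j ≫ (π j).hom ∧
        a.left.left t = w := by
    obtain ⟨j, v, hv⟩ := hV ((π i).hom.left.left w)
    obtain ⟨z, hz, -⟩ := exists_preimage_over
      (IsPullback.of_hasPullback (π i).hom (φ j ≫ (π j).hom)) w v hv.symm
    exact ⟨j, _, _, _, z, pullback.condition, hz⟩
  have hclopen (i : ι) : IsClopen (C i) := by
    constructor
    · rw [← isOpen_compl_iff, isOpen_iff_forall_mem_open]
      intro w hw
      obtain ⟨j, T, a, b, t, hab, rfl⟩ := hex i w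
      refine ⟨a.left.left '' {t | Related Φ (s i) (s j) a (b ≫ φ j) t}ᶜ, ?_,
        isOpenMap_over a _ (isClopen_related hY a _).compl.isOpen, t, ?_, rfl⟩
      · rintro _ ⟨t', ht', rfl⟩
        rwa [Set.mem_compl_iff, hC a b hab]
      · rwa [Set.mem_compl_iff, hC a b hab] at hw
    · rw [isOpen_iff_forall_mem_open]
      intro w hw
      obtain ⟨j, T, a, b, t, hab, rfl⟩ := hex i w
      refine ⟨a.left.left '' {t | Related Φ (s i) (s j) a (b ≫ φ j) t}, ?_,
        isOpenMap_over a _ (isOpen_related a _), t, ?_, rfl⟩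
      · rintro _ ⟨t', ht', rfl⟩
        rwa [hC a b hab]
      · rwa [hC a b hab] at hw
  choose N n hn hn' hlift using fun i => exists_clopen_subobject (Wᵢ i).property (hclopen i)
  have hφ (i : ι) (v : (V i).left.left) : (φ i).left.left v ∈ C i := by
    rw [hC (φ i) (𝟙 _) (by simp), Category.id_comp]
    exact .refl _ _ _
  choose q hq using fun i => hlift i (φ i) (hφ i)
  let n' (i : ι) : N i ⟶ Wᵢ i := ObjectProperty.homMk (n i)
  have hsheaf : (Presieve.ofArrows N fun i => n' i ≫ π i).IsSheafFor Φ := by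
    refine hΦ W _ fun w => ?_
    obtain ⟨i, v, rfl⟩ := hV w
    refine ⟨N i, _, (q i).left.left v, ⟨i⟩, ?_⟩
    change (q i ≫ n i ≫ (π i).hom).left.left v = _
    rw [reassoc_of% hq]
  rw [Presieve.isSheafFor_arrows_iff] at hsheaf
  obtain ⟨x, hx, -⟩ := hsheaf (fun i => Φ.map (n' i).op (s i)) (by
    intro i j Z gi gj hg
    dsimp only
    rw [← types_comp_apply, ← types_comp_apply, ← Φ.map_comp, ← Φ.map_comp, ← op_comp, ← op_comp]
    refine eq_of_related hΦ fun t => ?_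
    have hg' : (gi ≫ n' i).hom ≫ (π i).hom = (gj ≫ n' j).hom ≫ (π j).hom := by
      simpa using congr_arg InducedCategory.Hom.hom hg
    obtain ⟨k, v, hv⟩ := hV (((gi ≫ n' i).hom ≫ (π i).hom).left.left t)
    obtain ⟨z, rfl, rfl⟩ := exists_preimage_over (IsPullback.of_hasPullback
      ((gi ≫ n' i).hom ≫ (π i).hom) (φ k ≫ (π k).hom)) t v hv.symm
    rw [← related_precomp_iff]
    refine Related.trans (s' := s k) (b := pullback.snd _ _ ≫ φ k) ?_ (Related.symm ?_)
    · rw [← hC _ _ (by rw [Category.assoc, pullback.condition])]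
      exact hn i _
    · rw [← hC _ _ (by rw [Category.assoc, ← hg', pullback.condition])]
      exact hn j _)
  exact ⟨x, fun i => ⟨N i, n' i, q i, hq i, hx i⟩⟩

end Descent

end Faltings

/-! ### Smallness of the quasi-compact étale site -/

namespace Faltings

open Opposite

section Smallness

variable (S : Scheme.{u})

/-- A small skeleton of the affine étale `S`-schemes, as a full subcategory of the étale ones. -/
noncomputable abbrev smallAffine : SmallModel.{u} S.AffineEtale ⥤ S.Etale :=
  (equivSmallModel.{u} S.AffineEtale).inverse ⋙ Scheme.AffineEtale.Spec S

variable {S}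

lemma exists_smallAffine (V : S.Etale) [IsAffine V.left] :
    ∃ w, Nonempty ((smallAffine S).obj w ≅ V) := by
  let f : Spec Γ(V.left, ⊤) ⟶ S := V.left.isoSpec.inv ≫ V.hom
  let A : S.AffineEtale := Scheme.AffineEtale.mk f
  let e : (Scheme.AffineEtale.Spec S).obj A ≅ V :=
    MorphismProperty.Over.isoMk V.left.isoSpec.symm rfl
  exact ⟨(equivSmallModel.{u} S.AffineEtale).functor.obj A,
    ⟨(Scheme.AffineEtale.Spec S).mapIso ((equivSmallModel.{u} S.AffineEtale).unitIso.app A).symm ≪≫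
      e⟩⟩

/-- Every point of an étale `S`-scheme has an affine open neighbourhood in the small skeleton. -/
lemma exists_smallAffine_nhds (V : S.Etale) (x : V.left) :
    ∃ (w : SmallModel.{u} S.AffineEtale) (p : (smallAffine S).obj w ⟶ V),
      IsOpenImmersion p.left ∧ x ∈ Set.range p.left := by
  let j := V.left.affineCover.f (V.left.affineCover.idx x)
  let V' : S.Etale := MorphismProperty.Over.mk ⊤ (j ≫ V.hom) (inferInstanceAs (Etale _))
  let p : V' ⟶ V := MorphismProperty.Over.homMk j rfl trivial
  have : IsAffine V'.left := inferInstanceAs (IsAffine (V.left.affineCover.X _))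
  obtain ⟨w, ⟨e⟩⟩ := exists_smallAffine V'
  have hj : IsOpenImmersion p.left := inferInstanceAs (IsOpenImmersion j)
  have he : IsIso e.hom.left :=
    inferInstanceAs (IsIso ((Scheme.Etale.forget S ⋙ Over.forget S).map e.hom))
  refine ⟨w, e.hom ≫ p, inferInstanceAs (IsOpenImmersion (e.hom.left ≫ p.left)), ?_⟩
  obtain ⟨y, hy⟩ := V.left.affineCover.covers x
  obtain ⟨z, hz⟩ := (Scheme.homeoOfIso (asIso e.hom.left)).surjective y
  refine ⟨z, ?_⟩
  exact (congr_arg j hz).trans hy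

lemma hom_ext_smallAffine {T V : S.Etale} {g g' : T ⟶ V}
    (h : ∀ w (a : (smallAffine S).obj w ⟶ T), a ≫ g = a ≫ g') : g = g' := by
  apply (Scheme.Etale.forget S ⋙ Over.forget S).map_injective
  choose w p hp hx using exists_smallAffine_nhds T
  let 𝒰 : T.left.OpenCover := Scheme.Cover.mkOfCovers T.left (fun x => _) (fun x => (p x).left)
    (fun x => ⟨x, hx x⟩) hp
  exact 𝒰.hom_ext _ _ fun x => congr_arg (Scheme.Etale.forget S ⋙ Over.forget S).map (h _ (p x))

lemma exists_hom_of_atlas {ι : Type} {w : ι → SmallModel.{u} S.AffineEtale} {V V' : S.Etale}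
    (p : ∀ i, (smallAffine S).obj (w i) ⟶ V) (hp : ∀ i, IsOpenImmersion (p i).left)
    (hx : ∀ x : V.left, ∃ i, x ∈ Set.range (p i).left)
    (p' : ∀ i, (smallAffine S).obj (w i) ⟶ V')
    (h : ∀ i j T (a : T ⟶ w i) (b : T ⟶ w j),
      (smallAffine S).map a ≫ p i = (smallAffine S).map b ≫ p j →
      (smallAffine S).map a ≫ p' i = (smallAffine S).map b ≫ p' j) :
    ∃ g : V ⟶ V', ∀ i, p i ≫ g = p' i := by
  let 𝒰 : V.left.OpenCover := Scheme.Cover.mkOfCovers ι (fun i => _) (fun i => (p i).left)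
    hx hp
  have hc (i j) : pullback.fst (p i) (p j) ≫ p' i = pullback.snd (p i) (p j) ≫ p' j := by
    refine hom_ext_smallAffine fun t a => ?_
    obtain ⟨a', ha'⟩ := (smallAffine S).map_surjective (a ≫ pullback.fst (p i) (p j))
    obtain ⟨b', hb'⟩ := (smallAffine S).map_surjective (a ≫ pullback.snd (p i) (p j))
    rw [← Category.assoc, ← Category.assoc, ← ha', ← hb']
    apply h
    rw [ha', hb', Category.assoc, Category.assoc, pullback.condition]
  have sq (i j) := (IsPullback.of_hasPullback (p i) (p j)).map (Scheme.Etale.forget S ⋙ Over.forget S)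
  let g₀ : V.left ⟶ V'.left := 𝒰.glueMorphisms (fun i => (p' i).left) (by
    intro i j
    refine (cancel_epi (sq i j).isoPullback.hom).1 ?_
    refine ((sq i j).isoPullback_hom_fst_assoc _).trans (Eq.trans ?_
      ((sq i j).isoPullback_hom_snd_assoc _).symm)
    exact congr_arg (Scheme.Etale.forget S ⋙ Over.forget S).map (hc i j))
  have hg (i) : (p i).left ≫ g₀ = (p' i).left := 𝒰.ι_glueMorphisms _ _ i
  have hw : g₀ ≫ V'.hom = V.hom := by
    refine 𝒰.hom_ext _ _ fun i => ?_
    change (p i).left ≫ g₀ ≫ V'.hom = (p i).left ≫ V.hom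
    rw [reassoc_of% (hg i)]
    exact (CategoryTheory.Over.w ((Scheme.Etale.forget S).map (p' i))).trans
      (CategoryTheory.Over.w ((Scheme.Etale.forget S).map (p i))).symm
  refine ⟨MorphismProperty.Over.homMk g₀ hw trivial, fun i => ?_⟩
  exact (Scheme.Etale.forget S ⋙ Over.forget S).map_injective (hg i)

/-- The étale `S`-scheme `V` is covered by the finitely many affine étale `S`-schemes `wᵢ`, embedded
as open subschemes, and `R` is the set of all pairs of morphisms from affine étale `S`-schemes to
`wᵢ` and `wⱼ` which become equal in `V`. The gluing data are encoded by `R` as a subset of a small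
set, so that the atlases form a small set too. -/
def IsAtlas (V : S.Etale) {n : ℕ} (w : Fin n → SmallModel.{u} S.AffineEtale)
    (R : ∀ i j T, Set ((T ⟶ w i) × (T ⟶ w j))) : Prop :=
  ∃ p : ∀ i, (smallAffine S).obj (w i) ⟶ V, (∀ i, IsOpenImmersion (p i).left) ∧
    (∀ x : V.left, ∃ i, x ∈ Set.range (p i).left) ∧
    ∀ i j T a b, (a, b) ∈ R i j T ↔ (smallAffine S).map a ≫ p i = (smallAffine S).map b ≫ p j

/-- A scheme is determined up to isomorphism by an atlas. -/
lemma IsAtlas.nonempty_iso {V V' : S.Etale} {n : ℕ} {w : Fin n → SmallModel.{u} S.AffineEtale}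
    {R : ∀ i j T, Set ((T ⟶ w i) × (T ⟶ w j))} (h : IsAtlas V w R) (h' : IsAtlas V' w R) :
    Nonempty (V ≅ V') := by
  obtain ⟨p, hp, hx, hr⟩ := h
  obtain ⟨p', hp', hx', hr'⟩ := h'
  obtain ⟨g, hg⟩ := exists_hom_of_atlas p hp hx p'
    fun i j T a b hab => (hr' i j T a b).1 ((hr i j T a b).2 hab)
  obtain ⟨g', hg'⟩ := exists_hom_of_atlas p' hp' hx' p
    fun i j T a b hab => (hr i j T a b).1 ((hr' i j T a b).2 hab)
  have key {U U' : S.Etale} (q : ∀ i, (smallAffine S).obj (w i) ⟶ U)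
      (hq : ∀ i, IsOpenImmersion (q i).left) (hx : ∀ x : U.left, ∃ i, x ∈ Set.range (q i).left)
      (k k' : U ⟶ U') (hk : ∀ i, q i ≫ k = q i ≫ k') : k = k' := by
    apply (Scheme.Etale.forget S ⋙ Over.forget S).map_injective
    let 𝒰 : U.left.OpenCover := Scheme.Cover.mkOfCovers (Fin n) (fun i => _)
      (fun i => (q i).left) hx hq
    exact 𝒰.hom_ext _ _ fun x => congr_arg (Scheme.Etale.forget S ⋙ Over.forget S).map (hk x)
  refine ⟨⟨g, g', key p hp hx _ _ fun i => ?_, key p' hp' hx' _ _ fun i => ?_⟩⟩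
  · rw [reassoc_of% (hg i), hg', Category.comp_id]
  · rw [reassoc_of% (hg' i), hg, Category.comp_id]

lemma exists_isAtlas (V : S.Etale) [CompactSpace V.left] :
    ∃ (n : ℕ) (w : Fin n → SmallModel.{u} S.AffineEtale) (R : _), IsAtlas V w R := by
  choose w p hp hx using exists_smallAffine_nhds V
  obtain ⟨s, hs⟩ := isCompact_univ.elim_finite_subcover (fun x => Set.range (p x).left)
    (fun x => (hp x).isOpen_range) (fun x _ => Set.mem_iUnion.2 ⟨x, hx x⟩)
  let e := s.equivFin
  refine ⟨s.card, fun i => w (e.symm i).1, fun i j T => {x | (smallAffine S).map x.1 ≫ p _ =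
    (smallAffine S).map x.2 ≫ p _}, fun i => p _, fun i => hp _, fun x => ?_, fun _ _ _ _ _ => Iff.rfl⟩
  have := hs (Set.mem_univ x)
  simp only [Set.mem_iUnion] at this
  obtain ⟨y, hy, hxy⟩ := this
  obtain ⟨i, hi⟩ := e.symm.surjective ⟨y, hy⟩
  refine ⟨i, ?_⟩
  have (z : s) (hz : z = ⟨y, hy⟩) : x ∈ Set.range (p z.1).left := by rwa [hz]
  exact this _ hi

/-- The quasi-compact étale `S`-schemes. -/
def compactObj (S : Scheme.{u}) : ObjectProperty S.Etale := fun V => CompactSpace V.left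

instance : ObjectProperty.EssentiallySmall.{u} (compactObj S) where
  exists_small_le' := by
    let D : Type u := Σ (n : ℕ) (w : Fin n → SmallModel.{u} S.AffineEtale),
      ∀ i j T, Set ((T ⟶ w i) × (T ⟶ w j))
    let I := {d : D // ∃ V : S.Etale, IsAtlas V d.2.1 d.2.2}
    refine ⟨ObjectProperty.ofObj fun d : I => d.2.choose, inferInstance,
      fun V (_ : CompactSpace V.left) => ?_⟩
    obtain ⟨n, w, R, h⟩ := exists_isAtlas V
    let d : I := ⟨⟨n, w, R⟩, V, h⟩
    exact ⟨_, ⟨d⟩, h.nonempty_iso d.2.choose_spec⟩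

/-- The affine étale `S`-schemes. -/
def affineObj (S : Scheme.{u}) : ObjectProperty S.Etale := fun V => IsAffine V.left

instance : ObjectProperty.EssentiallySmall.{u} (affineObj S) :=
  .of_le (Q := compactObj S) fun V (_ : IsAffine V.left) => inferInstanceAs (CompactSpace V.left)

end Smallness

end Faltings

/-! ### Étale coverings and base change -/

namespace Faltings

open Opposite Covanishing

section EtaleSite

variable {S : Scheme.{u}}

/-- A sieve is covering for the étale topology if and only if its members are jointly surjective. -/
lemma mem_smallEtaleTopology_iff {V : S.Etale} {T : Sieve V} :
    T ∈ S.smallEtaleTopology V ↔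
      ∀ x : V.left, ∃ (W : S.Etale) (g : W ⟶ V), T g ∧ x ∈ Set.range g.left := by
  let ι := Σ W : S.Etale, {g : W ⟶ V // T g}
  have h : T = Sieve.ofArrows (fun i : ι => i.1) (fun i => i.2.1) := by
    ext W g
    rw [Sieve.mem_ofArrows_iff]
    refine ⟨fun hg => ⟨⟨W, g, hg⟩, 𝟙 W, (Category.id_comp g).symm⟩, ?_⟩
    rintro ⟨i, a, rfl⟩
    exact T.downward_closed i.2.2 a
  rw [h, Scheme.ofArrows_mem_smallEtaleTopology_iff, Set.eq_univ_iff_forall, ← h]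
  refine forall_congr' fun x => ?_
  rw [Set.mem_iUnion]
  refine ⟨?_, ?_⟩
  · rintro ⟨i, hi⟩
    exact ⟨_, _, i.2.2, hi⟩
  · rintro ⟨W, g, hg, hx⟩
    exact ⟨⟨W, g, hg⟩, hx⟩

lemma exists_affine_of_mem {V : S.Etale} {T : Sieve V} (hT : T ∈ S.smallEtaleTopology V)
    (x : V.left) : ∃ (W : S.Etale) (g : W ⟶ V), IsAffine W.left ∧ T g ∧ x ∈ Set.range g.left := by
  obtain ⟨W, g, hg, y, rfl⟩ := mem_smallEtaleTopology_iff.1 hT x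
  obtain ⟨w, p, _, z, rfl⟩ := exists_smallAffine_nhds W y
  exact ⟨_, p ≫ g, inferInstanceAs (IsAffine (Spec _)), T.downward_closed hg p, z, rfl⟩

lemma isOpenMap_etale {V W : S.Etale} (g : W ⟶ V) : IsOpenMap g.left := g.left.isOpenMap

lemma mem_smallEtaleTopology_of_affine {V : S.Etale} {T : Sieve V}
    (h : ∀ ⦃W : S.Etale⦄ (g : W ⟶ V), affineObj S W → T g) : T ∈ S.smallEtaleTopology V := by
  refine mem_smallEtaleTopology_iff.2 fun x => ?_
  obtain ⟨W, g, hW, -, hx⟩ := exists_affine_of_mem (S.smallEtaleTopology.top_mem V) x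
  exact ⟨W, g, h g hW, hx⟩

lemma exists_finite_refinement {V : S.Etale} {T : Sieve V} (hV : compactObj S V)
    (hT : T ∈ S.smallEtaleTopology V) :
    ∃ (n : ℕ) (W : Fin n → S.Etale) (t : ∀ i, W i ⟶ V), (∀ i, compactObj S (W i)) ∧
      (∀ i, T (t i)) ∧ Sieve.ofArrows W t ∈ S.smallEtaleTopology V := by
  have : CompactSpace V.left := hV
  choose W g hW hg hx using exists_affine_of_mem hT
  obtain ⟨s, hs⟩ := isCompact_univ.elim_finite_subcover (fun x => Set.range (g x).left)
    (fun x => (isOpenMap_etale (g x)).isOpen_range) (fun x _ => Set.mem_iUnion.2 ⟨x, hx x⟩)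
  let e := s.equivFin
  refine ⟨s.card, fun i => W (e.symm i).1, fun i => g _, fun i => ?_, fun i => hg _, ?_⟩
  · have := hW (e.symm i).1
    exact inferInstanceAs (CompactSpace (W (e.symm i).1).left)
  · rw [Scheme.ofArrows_mem_smallEtaleTopology_iff, Set.eq_univ_iff_forall]
    intro x
    have := hs (Set.mem_univ x)
    simp only [Set.mem_iUnion] at this ⊢
    obtain ⟨y, hy, hxy⟩ := this
    obtain ⟨i, hi⟩ := e.symm.surjective ⟨y, hy⟩
    refine ⟨i, ?_⟩
    have (z : s) (hz : z = ⟨y, hy⟩) : x ∈ Set.range (g z.1).left := by rwa [hz]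
    exact this _ hi

lemma isPullback_left {P A B C : S.Etale} {p : P ⟶ A} {q : P ⟶ B} {a : A ⟶ C} {b : B ⟶ C}
    (h : IsPullback p q a b) : IsPullback p.left q.left a.left b.left :=
  h.map (Scheme.Etale.forget S ⋙ Over.forget S)

end EtaleSite

variable {X Y : Scheme.{u}} (f : Y ⟶ X)

/-- The étale `Y`-scheme `(etalePullback f).obj U` is naturally isomorphic to `U ×[X] Y`. -/
lemma exists_etalePullback_iso : ∃ e : ∀ U : X.Etale,
    ((etalePullback f).obj U).left ≅ ((Over.pullback f).obj ((Scheme.Etale.forget X).obj U)).left,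
    (∀ U, (e U).hom ≫ pullback.snd U.hom f = ((etalePullback f).obj U).hom) ∧
    ∀ {U U' : X.Etale} (h : U' ⟶ U), ((etalePullback f).map h).left ≫ (e U).hom =
      (e U').hom ≫ ((Over.pullback f).map ((Scheme.Etale.forget X).map h)).left :=
  ⟨fun U => (Over.forget Y).mapIso ((etalePullbackForget f).app U), fun U =>
    CategoryTheory.Over.w ((etalePullbackForget f).hom.app U), fun h =>
    congr_arg (Over.forget Y).map ((etalePullbackForget f).hom.naturality h)⟩

/-- A property of morphisms of schemes stable under base change passes from `U' ⟶ U` to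
`U'_Y ⟶ U_Y`. -/
lemma etalePullback_map_of (P : MorphismProperty Scheme.{u}) [P.IsStableUnderBaseChange]
    {U U' : X.Etale} (h : U' ⟶ U) (hP : P h.left) :
    P ((etalePullback f).map h).left := by
  have := MorphismProperty.IsStableUnderBaseChange.respectsIso (P := P)
  obtain ⟨e, -, he⟩ := exists_etalePullback_iso f
  have h1 : P ((Over.pullback f).map ((Scheme.Etale.forget X).map h)).left :=
    P.overPullbackMap f ((Scheme.Etale.forget X).map h) hP
  have h2 := he h
  rw [← Iso.eq_comp_inv] at h2
  rw [h2, Category.assoc]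
  exact (P.cancel_left_of_respectsIso _ _).2 ((P.cancel_right_of_respectsIso _ _).2 h1)

/-- A property of morphisms of schemes stable under base change passes from `U ⟶ X` to `U_Y ⟶ Y`. -/
lemma etalePullback_hom_of (P : MorphismProperty Scheme.{u}) [P.IsStableUnderBaseChange]
    (U : X.Etale) (hP : P U.hom) : P ((etalePullback f).obj U).hom := by
  have := MorphismProperty.IsStableUnderBaseChange.respectsIso (P := P)
  obtain ⟨e, he, -⟩ := exists_etalePullback_iso f
  rw [← he]
  exact (P.cancel_left_of_respectsIso _ _).2 (P.pullback_snd U.hom f hP)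

lemma compactSpace_etalePullback [QuasiSeparatedSpace X] [CompactSpace Y] {U : X.Etale}
    (hU : affineObj X U) : CompactSpace ((etalePullback f).obj U).left := by
  have : IsAffine U.left := hU
  have h : QuasiCompact U.hom := quasiCompact_of_compactSpace (X := U.left) (Y := X) U.hom
  have := etalePullback_hom_of f @QuasiCompact U h
  exact QuasiCompact.compactSpace_of_compactSpace (X := ((etalePullback f).obj U).left) (Y := Y)
    ((etalePullback f).obj U).hom

lemma quasiSeparatedSpace_etalePullback [QuasiSeparatedSpace Y] {U : X.Etale}
    (hU : affineObj X U) : QuasiSeparatedSpace ((etalePullback f).obj U).left := by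
  have : IsAffine U.left := hU
  have h : QuasiSeparated U.hom :=
    QuasiSeparated.of_quasiSeparatedSpace (X := U.left) (Y := X) U.hom
  have := etalePullback_hom_of f @QuasiSeparated U h
  exact quasiSeparatedSpace_of_quasiSeparated (X := ((etalePullback f).obj U).left) (Y := Y)
    ((etalePullback f).obj U).hom

lemma compactObj_pullback {U U' : X.Etale} (h : U' ⟶ U) {V : Y.Etale}
    (v : V ⟶ (etalePullback f).obj U) (hU : affineObj X U) (hU' : affineObj X U')
    (hV : compactObj Y V) : compactObj Y (pullback v ((etalePullback f).map h)) := by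
  have h1 : IsAffine U.left := hU
  have h2 : IsAffine U'.left := hU'
  have h3 : CompactSpace V.left := hV
  have h4 : QuasiCompact h.left := quasiCompact_of_compactSpace h.left
  have h5 : QuasiCompact ((etalePullback f).map h).left := etalePullback_map_of f @QuasiCompact h h4
  have sq := isPullback_left (IsPullback.of_hasPullback v ((etalePullback f).map h))
  have h6 : QuasiCompact (pullback.fst v ((etalePullback f).map h)).left :=
    MorphismProperty.of_isPullback (P := @QuasiCompact) sq.flip h5
  exact QuasiCompact.compactSpace_of_compactSpace (pullback.fst v ((etalePullback f).map h)).left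

lemma isFinitary : IsFinitary (etalePullback f) X.smallEtaleTopology Y.smallEtaleTopology
    (affineObj X) (compactObj Y) where
  dense _ _ h := mem_smallEtaleTopology_of_affine h
  finite _ _ hV hS := exists_finite_refinement hV hS
  baseChange _ _ _ h v hU hU' hV := compactObj_pullback f h v hU hU' hV

end Faltings

/-! ### The small Faltings site -/

namespace Faltings

open Opposite Covanishing

variable {X Y : Scheme.{u}} (f : Y ⟶ X)

/-- The objects `V ⟶ U_Y` with `U` affine and `V` quasi-compact. -/
def smallObjects : ObjectProperty (CovanishingCat f) :=
  fun Z => affineObj X Z.right ∧ compactObj Y Z.left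

instance : ObjectProperty.EssentiallySmall.{u} (smallObjects f) where
  exists_small_le' := by
    obtain ⟨Q, _, -, hQ⟩ := ObjectProperty.EssentiallySmall.exists_small_le.{u} (affineObj X)
    obtain ⟨Q', _, -, hQ'⟩ := ObjectProperty.EssentiallySmall.exists_small_le.{u} (compactObj Y)
    let I := Σ (a : Subtype Q) (b : Subtype Q'), (b.1 ⟶ (etalePullback f).obj a.1)
    refine ⟨ObjectProperty.ofObj fun i : I => (⟨i.2.1.1, i.1.1, i.2.2⟩ : CovanishingCat f),
      inferInstance, fun Z hZ => ?_⟩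
    obtain ⟨a, ha, ⟨ea⟩⟩ := hQ _ hZ.1
    obtain ⟨b, hb, ⟨eb⟩⟩ := hQ' _ hZ.2
    let i : I := ⟨⟨a, ha⟩, ⟨b, hb⟩, eb.inv ≫ Z.hom ≫ (etalePullback f).map ea.hom⟩
    exact ⟨_, ⟨i⟩, ⟨Comma.isoMk eb ea (by simp [i])⟩⟩

/-- The full subcategory of the co-vanishing site of the objects `V ⟶ U_Y` with `U` affine and `V`
quasi-compact. -/
abbrev SmallCovanishingCat := (smallObjects f).FullSubcategory

/-- The full subcategory of the Faltings site of the objects `V ⟶ U_Y` with `U` affine and `V`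
quasi-compact. -/
abbrev SmallFaltingsCat := ((smallObjects f).inverseImage (rhoPlus f)).FullSubcategory

/-- The inclusion of the small co-vanishing site in the co-vanishing site. -/
noncomputable abbrev smallCovanishingι : SmallCovanishingCat f ⥤ CovanishingCat f :=
  (smallObjects f).ι

/-- The inclusion of the small Faltings site in the Faltings site. -/
noncomputable abbrev smallFaltingsι : SmallFaltingsCat f ⥤ FaltingsCat f :=
  ((smallObjects f).inverseImage (rhoPlus f)).ι

/-- The inclusion of the small Faltings site in the co-vanishing site. -/
noncomputable abbrev smallRho : SmallFaltingsCat f ⥤ CovanishingCat f :=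
  smallFaltingsι f ⋙ rhoPlus f

/-- The inclusion of the small Faltings site in the small co-vanishing site. -/
noncomputable def smallFaltingsToSmallCovanishing : SmallFaltingsCat f ⥤ SmallCovanishingCat f :=
  (smallObjects f).lift (smallRho f) fun Z => Z.property

instance : (smallFaltingsToSmallCovanishing f).Full :=
  Functor.Full.of_comp_faithful_iso
    ((smallObjects f).liftCompιIso (smallRho f) fun Z => Z.property)

instance : (smallFaltingsToSmallCovanishing f).Faithful :=
  Functor.Faithful.of_comp_iso ((smallObjects f).liftCompιIso (smallRho f) fun Z => Z.property)

instance : EssentiallySmall.{u} (SmallCovanishingCat f) := inferInstance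

instance : EssentiallySmall.{u} (SmallFaltingsCat f) :=
  essentiallySmall_of_fully_faithful (smallFaltingsToSmallCovanishing f)

lemma mem_covTopology_of_cartesian {Z : CovanishingCat f} {T : Sieve Z}
    (h : ∀ ⦃U : X.Etale⦄ (h : U ⟶ Z.right), affineObj X U → T (cartHom Z h)) :
    T ∈ covTopology f Z := by
  let R : Presieve Z := fun Z' c => IsCart c ∧ T c
  refine (covTopology f).superset_covering (S := Sieve.generate R) ?_
    (Precoverage.generate_mem_toGrothendieck (J := covPrecoverage f) (Or.inr ⟨?_, fun W g hg => hg.1⟩))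
  · rw [Sieve.generate_le_iff]
    exact fun _ _ hg => hg.2
  · refine mem_smallEtaleTopology_of_affine fun U h' hU => ?_
    exact Sieve.le_generate _ _ _ (Presieve.map_map (F := Comma.snd _ _)
      (show R (cartHom Z h') from ⟨isCart_cartHom Z h', h h' hU⟩))

lemma mem_covTopology_of_vertical {Z : CovanishingCat f} {T : Sieve Z}
    (h : vertSieve T ∈ Y.smallEtaleTopology Z.left) : T ∈ covTopology f Z := by
  let R : Presieve Z := fun Z' c => IsIso c.right ∧ T c
  refine (covTopology f).superset_covering (S := Sieve.generate R) ?_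
    (Precoverage.generate_mem_toGrothendieck (J := covPrecoverage f) (Or.inl ⟨fun W g hg => hg.1, ?_⟩))
  · rw [Sieve.generate_le_iff]
    exact fun _ _ hg => hg.2
  · refine (Y.smallEtaleTopology).superset_covering (S := vertSieve T) (fun V t ht => ?_) h
    exact Sieve.le_generate _ _ _ (Presieve.map_map (F := Comma.fst _ _)
      (show R (vertHom Z t) from ⟨inferInstanceAs (IsIso (𝟙 _)), ht⟩))

instance : (smallCovanishingι f).IsCoverDense (covTopology f) where
  is_cover Z := by
    let S : Sieve Z := Sieve.generate fun Z' _ => affineObj X Z'.right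
    have hS : S ∈ covTopology f Z := mem_covTopology_of_cartesian f fun U h hU =>
      Sieve.le_generate _ _ _ hU
    refine (covTopology f).transitive hS _ ?_
    rintro _ _ ⟨Z', a, g, hZ', rfl⟩
    rw [Sieve.pullback_comp]
    refine (covTopology f).pullback_stable _ (mem_covTopology_of_vertical f
      (mem_smallEtaleTopology_of_affine fun V t (hV : IsAffine V.left) => ?_))
    let Z'' : SmallCovanishingCat f := ⟨vertObj Z' t, hZ', inferInstanceAs (CompactSpace V.left)⟩
    exact ⟨⟨Z'', 𝟙 _, vertHom Z' t ≫ g, Category.id_comp _⟩⟩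

variable {f}

lemma finiteObjects_of_isCart {Z Z' : CovanishingCat f} {c : Z' ⟶ Z} (hc : IsCart c)
    (hZ : finiteObjects f Z) : finiteObjects f Z' :=
  MorphismProperty.of_isPullback (P := @IsFinite) (isPullback_left hc) hZ

lemma mem_faltingsTopology_of_cartesian {W : FaltingsCat f} {T : Sieve W}
    {R : Sieve W.obj.right} (hR : R ∈ X.smallEtaleTopology W.obj.right)
    (h : ∀ ⦃W' : FaltingsCat f⦄ (c : W' ⟶ W), IsCart c.hom → R c.hom.right → T c) :
    T ∈ faltingsTopology f W := by
  let Q : Presieve W := fun W' c => IsCart c.hom ∧ R c.hom.right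
  refine (faltingsTopology f).superset_covering (S := Sieve.generate Q) ?_
    (Precoverage.generate_mem_toGrothendieck (J := faltingsPrecoverage f) (Or.inr ⟨?_, ?_⟩))
  · rw [Sieve.generate_le_iff]
    exact fun _ _ hg => h _ hg.1 hg.2
  · refine (X.smallEtaleTopology).superset_covering (fun U k hk => ?_) hR
    let c : (⟨cartObj W.obj k, finiteObjects_of_isCart (isCart_cartHom W.obj k) W.property⟩ :
      FaltingsCat f) ⟶ W := ObjectProperty.homMk (cartHom W.obj k)
    exact Sieve.le_generate _ _ _ (Presieve.map_map (F := Comma.snd _ _)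
      (Presieve.map_map (F := rhoPlus f) (show Q c from ⟨isCart_cartHom W.obj k, hk⟩)))
  · rintro _ _ hg
    obtain @⟨W', g, hg⟩ := hg
    exact hg.1

lemma mem_faltingsTopology_of_vertical {W : FaltingsCat f} {T : Sieve W}
    (h : ∀ x : W.obj.left.left, ∃ (W' : FaltingsCat f) (c : W' ⟶ W), IsIso c.hom.right ∧ T c ∧
      x ∈ Set.range c.hom.left.left) :
    T ∈ faltingsTopology f W := by
  let Q : Presieve W := fun W' c => IsIso c.hom.right ∧ T c
  refine (faltingsTopology f).superset_covering (S := Sieve.generate Q) ?_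
    (Precoverage.generate_mem_toGrothendieck (J := faltingsPrecoverage f) (Or.inl ⟨?_, ?_⟩))
  · rw [Sieve.generate_le_iff]
    exact fun _ _ hg => hg.2
  · rintro _ _ hg
    obtain @⟨W', g, hg⟩ := hg
    exact hg.1
  · refine mem_smallEtaleTopology_iff.2 fun x => ?_
    obtain ⟨W', c, hc, hT, hx⟩ := h x
    exact ⟨_, c.hom.left, Sieve.le_generate _ _ _ (Presieve.map_map (F := Comma.fst _ _)
      (Presieve.map_map (F := rhoPlus f) (show Q c from ⟨hc, hT⟩))), hx⟩

lemma compactObj_of_finiteObjects [QuasiSeparatedSpace X] [CompactSpace Y] {Z : CovanishingCat f}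
    (hZ : finiteObjects f Z) (hU : affineObj X Z.right) : compactObj Y Z.left := by
  have h : IsFinite Z.hom.left := hZ
  have := compactSpace_etalePullback f hU
  exact QuasiCompact.compactSpace_of_compactSpace Z.hom.left

/-- An object `V ⟶ U_Y` of the Faltings site with `U` affine is in the small site: as `X` is
quasi-separated and `Y` is quasi-compact, `U_Y` is quasi-compact, and so is `V`. -/
lemma smallObjects_of_affine [QuasiSeparatedSpace X] [CompactSpace Y] (W : FaltingsCat f)
    (hU : affineObj X W.obj.right) : smallObjects f W.obj :=
  ⟨hU, compactObj_of_finiteObjects W.property hU⟩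

variable (f)

instance [QuasiSeparatedSpace X] [CompactSpace Y] :
    (smallFaltingsι f).IsCoverDense (faltingsTopology f) where
  is_cover W := by
    let R : Sieve W.obj.right := Sieve.generate fun U _ => affineObj X U
    have hR : R ∈ X.smallEtaleTopology W.obj.right :=
      mem_smallEtaleTopology_of_affine fun U h hU => Sieve.le_generate _ _ _ hU
    refine mem_faltingsTopology_of_cartesian hR fun W' c hc hk => ?_
    obtain ⟨U, a, b, hU, hab⟩ := hk
    let V : FaltingsCat f := ⟨cartObj W.obj b,
      finiteObjects_of_isCart (isCart_cartHom W.obj b) W.property⟩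
    let V' : SmallFaltingsCat f := ⟨V, smallObjects_of_affine V hU⟩
    let l : W' ⟶ V := ObjectProperty.homMk ((isCart_cartHom W.obj b).lift c.hom a hab)
    let k : V ⟶ W := ObjectProperty.homMk (cartHom W.obj b)
    refine ⟨⟨V', l, k, ?_⟩⟩
    ext1
    exact IsCart.lift_comp (isCart_cartHom W.obj b) c.hom a hab

/-- The topology of the small Faltings site, induced by that of the Faltings site. -/
noncomputable abbrev smallFaltingsTopology : GrothendieckTopology (SmallFaltingsCat f) :=
  (smallFaltingsι f).inducedTopology (faltingsTopology f)

/-- The topology of the small co-vanishing site, induced by that of the co-vanishing site. -/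
noncomputable abbrev smallCovTopology : GrothendieckTopology (SmallCovanishingCat f) :=
  (smallCovanishingι f).inducedTopology (covTopology f)

section Sheafification

instance (Z : (CovanishingCat f)ᵒᵖ) :
    HasLimitsOfShape (StructuredArrow Z (smallCovanishingι f).op) (Type u) :=
  hasLimitsOfShape_of_essentiallySmall _ _

instance : HasSheafify (smallCovTopology f) (Type u) :=
  hasSheafifyEssentiallySmallSite.{u} _ _

instance : HasSheafify (covTopology f) (Type u) :=
  Functor.IsDenseSubsite.hasSheafify_of_isEquivalence (smallCovTopology f) _ (smallCovanishingι f)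

instance : (smallCovTopology f).WEqualsLocallyBijective (Type u) :=
  .ofEssentiallySmall.{u} (smallCovTopology f)

instance : (covTopology f).WEqualsLocallyBijective (Type u) :=
  .transport _ _ _ (Functor.IsDenseSubsite.coverPreserving (smallCovTopology f) _
      (smallCovanishingι f))

variable [QuasiSeparatedSpace X] [CompactSpace Y]

instance (Z : (FaltingsCat f)ᵒᵖ) :
    HasLimitsOfShape (StructuredArrow Z (smallFaltingsι f).op) (Type u) :=
  hasLimitsOfShape_of_essentiallySmall _ _

instance : ((smallFaltingsι f).sheafPushforwardContinuous (Type u) (smallFaltingsTopology f)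
    (faltingsTopology f)).IsEquivalence := inferInstance

instance : (smallRho f).IsContinuous (smallFaltingsTopology f) (covTopology f) :=
  Functor.isContinuous_comp _ _ _ (faltingsTopology f) _

instance (Z : (CovanishingCat f)ᵒᵖ) :
    HasColimitsOfShape (CostructuredArrow (smallRho f).op Z) (Type u) :=
  hasColimitsOfShape_of_essentiallySmall _ _

end Sheafification

end Faltings

/-! ### Elements of left Kan extensions -/

namespace CategoryTheory

open Opposite

/-- In a colimit of sets over a category in which spans can be completed to commutative squares,
two elements are equal if and only if they become equal at some stage. -/
lemma exists_map_eq_of_isColimit {J : Type*} [Category* J] {D : J ⥤ Type u} {c : Cocone D}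
    (hc : IsColimit c)
    (hJ : ∀ ⦃i j k : J⦄ (f : j ⟶ i) (g : j ⟶ k), ∃ (l : J) (f' : i ⟶ l) (g' : k ⟶ l),
      f ≫ f' = g ≫ g') {i j : J} {x : D.obj i} {y : D.obj j} (h : c.ι.app i x = c.ι.app j y) :
    ∃ (k : J) (f : i ⟶ k) (g : j ⟶ k), D.map f x = D.map g y := by
  have hb := ((Types.isColimit_iff_coconeTypesIsColimit c).1 ⟨hc⟩).bijective.1
  have h' : D.ιColimitType i x = D.ιColimitType j y := hb h
  have key : ∀ p q : Σ j, D.obj j, Relation.EqvGen D.ColimitTypeRel p q →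
      ∃ (k : J) (f : p.1 ⟶ k) (g : q.1 ⟶ k), D.map f p.2 = D.map g q.2 := by
    intro p q hpq
    induction hpq with
    | rel p q h =>
      obtain ⟨f, hf⟩ := h
      exact ⟨q.1, f, 𝟙 _, by rw [← hf]; simp⟩
    | refl p => exact ⟨p.1, 𝟙 _, 𝟙 _, rfl⟩
    | symm p q _ ih =>
      obtain ⟨k, f, g, hfg⟩ := ih
      exact ⟨k, g, f, hfg.symm⟩
    | trans p q r _ _ ih ih' =>
      obtain ⟨k, f, g, hfg⟩ := ih
      obtain ⟨k', f', g', hfg'⟩ := ih'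
      obtain ⟨l, a, b, hab⟩ := hJ g f'
      refine ⟨l, f ≫ a, g' ≫ b, ?_⟩
      simp only [Functor.map_comp, types_comp_apply, hfg, ← hfg']
      rw [← types_comp_apply (D.map g), ← types_comp_apply (D.map f'), ← D.map_comp, hab, D.map_comp]
  exact key _ _ (Quot.eqvGen_exact h')

variable {C : Type u₁} [Category.{v₁} C] {D : Type u₂} [Category.{v₂} D] (G : C ⥤ D)
  (F : Cᵒᵖ ⥤ Type u) [∀ Z, HasColimitsOfShape (CostructuredArrow G.op Z) (Type u)]

/-- Every element of the left Kan extension of `F` comes from an element of `F`. -/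
lemma exists_lan_eq {Z : D} (p : (G.op.lan.obj F).obj (op Z)) :
    ∃ (W : C) (m : Z ⟶ G.obj W) (s : F.obj (op W)),
      p = (G.op.lan.obj F).map m.op ((G.op.lanUnit.app F).app (op W) s) := by
  obtain ⟨j, y, rfl⟩ := Types.jointly_surjective_of_isColimit
    (Functor.isPointwiseLeftKanExtensionLeftKanExtensionUnit G.op F (op Z)) p
  exact ⟨j.left.unop, j.hom.unop, y, rfl⟩

/-- When `C` has pullbacks which are preserved by `G`, two elements of the left Kan extension of `F`
along `G` are equal if and only if they have a common refinement. -/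
lemma exists_of_lan_eq [HasPullbacks C] [PreservesLimitsOfShape WalkingCospan G] {Z : D} {W W' : C}
    {m : Z ⟶ G.obj W} {m' : Z ⟶ G.obj W'} {s : F.obj (op W)} {s' : F.obj (op W')}
    (h : (G.op.lan.obj F).map m.op ((G.op.lanUnit.app F).app (op W) s) =
      (G.op.lan.obj F).map m'.op ((G.op.lanUnit.app F).app (op W') s')) :
    ∃ (W'' : C) (n : Z ⟶ G.obj W'') (a : W'' ⟶ W) (b : W'' ⟶ W'), n ≫ G.map a = m ∧
      n ≫ G.map b = m' ∧ F.map a.op s = F.map b.op s' := by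
  obtain ⟨k, a, b, hab⟩ := exists_map_eq_of_isColimit
    (Functor.isPointwiseLeftKanExtensionLeftKanExtensionUnit G.op F (op Z)) (by
      intro i j k f g
      have w₁ : i.hom.unop ≫ G.map f.left.unop = j.hom.unop :=
        congr_arg Quiver.Hom.unop (CostructuredArrow.w f)
      have w₂ : k.hom.unop ≫ G.map g.left.unop = j.hom.unop :=
        congr_arg Quiver.Hom.unop (CostructuredArrow.w g)
      have sq := (IsPullback.of_hasPullback f.left.unop g.left.unop).map G
      let n := sq.lift i.hom.unop k.hom.unop (w₁.trans w₂.symm)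
      have hn₁ := sq.lift_fst i.hom.unop k.hom.unop (w₁.trans w₂.symm)
      have hn₂ := sq.lift_snd i.hom.unop k.hom.unop (w₁.trans w₂.symm)
      refine ⟨CostructuredArrow.mk (S := G.op) (T := op Z)
          (Y := op (pullback f.left.unop g.left.unop)) n.op,
        CostructuredArrow.homMk (pullback.fst _ _).op (congr_arg Quiver.Hom.op hn₁),
        CostructuredArrow.homMk (pullback.snd _ _).op (congr_arg Quiver.Hom.op hn₂), ?_⟩
      ext
      exact congr_arg Quiver.Hom.op pullback.condition) (i := CostructuredArrow.mk
      (S := G.op) (T := op Z) (Y := op W) m.op) (j := CostructuredArrow.mk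
      (S := G.op) (T := op Z) (Y := op W') m'.op) (x := s) (y := s') h
  exact ⟨k.left.unop, k.hom.unop, a.left.unop, b.left.unop,
    congr_arg Quiver.Hom.unop (CostructuredArrow.w a),
    congr_arg Quiver.Hom.unop (CostructuredArrow.w b), hab⟩

end CategoryTheory

namespace Faltings

open Opposite Covanishing

variable {X Y : Scheme.{u}} (f : Y ⟶ X)

lemma isAffine_of_isPullback {P A B C : X.Etale} {p : P ⟶ A} {q : P ⟶ B} {a : A ⟶ C} {b : B ⟶ C}
    (h : IsPullback p q a b) (hA : affineObj X A) (hB : affineObj X B) (hC : affineObj X C) :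
    affineObj X P := by
  have h1 : IsAffine A.left := hA
  have h2 : IsAffine B.left := hB
  have h3 : IsAffine C.left := hC
  have := isPullback_left h
  exact .of_isIso (isPullback_left h).isoPullback.hom

variable [QuasiSeparatedSpace X] [CompactSpace Y]

instance : ((smallObjects f).inverseImage (rhoPlus f)).IsClosedUnderLimitsOfShape WalkingCospan where
  limitsOfShape_le := by
    rintro W ⟨h⟩
    have sq := (IsPullback.of_isLimit_cone h.isLimit).map (rhoPlus f ⋙ Comma.snd _ _)
    exact smallObjects_of_affine W (isAffine_of_isPullback sq (h.prop_diag_obj .left).1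
      (h.prop_diag_obj .right).1 (h.prop_diag_obj .one).1)

instance : HasPullbacks (SmallFaltingsCat f) := inferInstance

instance : PreservesLimitsOfShape WalkingCospan (smallRho f) := inferInstance

end Faltings

/-! ### Sections of the extension of a presheaf to the co-vanishing site -/

namespace Faltings

open Opposite Covanishing

variable {X Y : Scheme.{u}} (f : Y ⟶ X)

/-- The étale `U_Y`-schemes, as objects of the co-vanishing site over `U`. -/
noncomputable abbrev vertFunctor (U : X.Etale) : Over ((etalePullback f).obj U) ⥤ CovanishingCat f where
  obj T := ⟨T.left, U, T.hom⟩
  map g := { left := g.left, right := 𝟙 U, w := by simp }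

instance (U : X.Etale) : (vertFunctor f U).Faithful where
  map_injective h := Over.OverMorphism.ext (congr_arg CommaMorphism.left h :)

variable {f} in
/-- Morphisms of the co-vanishing site over the identity of `U` are morphisms over `U_Y`. -/
lemma exists_vertFunctor_map {U : X.Etale} {T T' : Over ((etalePullback f).obj U)}
    (g : (vertFunctor f U).obj T ⟶ (vertFunctor f U).obj T') (hg : g.right = 𝟙 U) :
    ∃ g' : T ⟶ T', (vertFunctor f U).map g' = g := by
  refine ⟨Over.homMk g.left ?_, ?_⟩
  · have := g.w
    rw [hg] at this
    rw [CategoryTheory.Functor.map_id] at this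
    exact this.trans (Category.comp_id _)
  · ext
    · rfl
    · exact hg.symm

/-- The canonical morphism from the base change of `T` along `r : U' ⟶ U` to `T`. -/
noncomputable def baseChangeHom {U U' : X.Etale} (r : U' ⟶ U) (T : Over ((etalePullback f).obj U)) :
    (vertFunctor f U').obj ((Over.pullback ((etalePullback f).map r)).obj T) ⟶
      (vertFunctor f U).obj T :=
  cartHom ((vertFunctor f U).obj T) r

lemma isCart_baseChangeHom {U U' : X.Etale} (r : U' ⟶ U) (T : Over ((etalePullback f).obj U)) :
    IsCart (baseChangeHom f r T) :=
  isCart_cartHom _ _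

lemma baseChangeHom_naturality {U U' : X.Etale} (r : U' ⟶ U)
    {T T' : Over ((etalePullback f).obj U)} (g : T ⟶ T') :
    (vertFunctor f U').map ((Over.pullback ((etalePullback f).map r)).map g) ≫
      baseChangeHom f r T' = baseChangeHom f r T ≫ (vertFunctor f U).map g := by
  ext
  · exact pullback.lift_fst _ _ _
  · exact (Category.id_comp _).trans (Category.comp_id _).symm

lemma finObj_baseChange {U U' : X.Etale} (r : U' ⟶ U) {T : Over ((etalePullback f).obj U)}
    (hT : finObj _ T) : finObj _ ((Over.pullback ((etalePullback f).map r)).obj T) :=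
  finiteObjects_of_isCart (isCart_baseChangeHom f r T) hT

section Extension

variable {f} (F : (SmallFaltingsCat f)ᵒᵖ ⥤ Type u)

/-- The left Kan extension of a presheaf on the small Faltings site to the co-vanishing site. -/
noncomputable abbrev extension : (CovanishingCat f)ᵒᵖ ⥤ Type u := (smallRho f).op.lan.obj F

lemma map_op_map {C : Type*} [Category* C] (P : Cᵒᵖ ⥤ Type u) {A B D : C} (g : A ⟶ B) (h : D ⟶ A)
    (x : P.obj (op B)) : P.map h.op (P.map g.op x) = P.map (h ≫ g).op x := by
  rw [op_comp, P.map_comp, types_comp_apply]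

variable {F} in
/-- The section of the extension of `F` defined by a section of `F`. -/
noncomputable def extUnit {W : SmallFaltingsCat f} (s : F.obj (op W)) :
    (extension F).obj (op W.obj.obj) :=
  ((smallRho f).op.lanUnit.app F).app (op W) s

lemma extUnit_map {W W' : SmallFaltingsCat f} (g : W' ⟶ W) (s : F.obj (op W)) :
    extUnit (F.map g.op s) = (extension F).map g.hom.hom.op (extUnit s) := by
  have := ((smallRho f).op.lanUnit.app F).naturality g.op
  exact ConcreteCategory.congr_hom this s

end Extension

variable [QuasiSeparatedSpace X] [CompactSpace Y]

/-- The finite étale `U_Y`-schemes, for `U` affine, as objects of the small Faltings site. -/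
noncomputable abbrev fibreFunctor {U : X.Etale} (hU : affineObj X U) :
    (finObj ((etalePullback f).obj U)).FullSubcategory ⥤ SmallFaltingsCat f where
  obj N := ⟨⟨(vertFunctor f U).obj N.obj, N.property⟩,
    smallObjects_of_affine (⟨(vertFunctor f U).obj N.obj, N.property⟩ : FaltingsCat f) hU⟩
  map g := ObjectProperty.homMk (ObjectProperty.homMk ((vertFunctor f U).map g.hom))

/-- The base change of finite étale schemes along `U' ⟶ U`. -/
noncomputable abbrev finBaseChange {U U' : X.Etale} (r : U' ⟶ U) :
    (finObj ((etalePullback f).obj U)).FullSubcategory ⥤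
      (finObj ((etalePullback f).obj U')).FullSubcategory where
  obj N := ⟨(Over.pullback ((etalePullback f).map r)).obj N.obj, finObj_baseChange f r N.property⟩
  map g := ObjectProperty.homMk ((Over.pullback ((etalePullback f).map r)).map g.hom)

/-- The morphism `baseChangeHom`, as a morphism of the small Faltings site. -/
noncomputable def finBaseChangeHom {U U' : X.Etale} (hU : affineObj X U) (hU' : affineObj X U')
    (r : U' ⟶ U) (N : (finObj ((etalePullback f).obj U)).FullSubcategory) :
    (fibreFunctor f hU').obj ((finBaseChange f r).obj N) ⟶ (fibreFunctor f hU).obj N :=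
  ObjectProperty.homMk (ObjectProperty.homMk (baseChangeHom f r N.obj))

section Lan

variable {f} (F : (SmallFaltingsCat f)ᵒᵖ ⥤ Type u)

variable {F} in
/-- The section of the extension of `F` over `T ⟶ U` defined by a morphism from `T` to a finite
étale `U_Y`-scheme `N` and a section of `F` over `N ⟶ U`. -/
noncomputable def extElt {U : X.Etale} (hU : affineObj X U) {T : Over ((etalePullback f).obj U)}
    {N : (finObj ((etalePullback f).obj U)).FullSubcategory} (m : T ⟶ N.obj)
    (s : F.obj (op ((fibreFunctor f hU).obj N))) :
    (extension F).obj (op ((vertFunctor f U).obj T)) :=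
  (extension F).map ((vertFunctor f U).map m).op (extUnit s)

lemma extElt_map {U : X.Etale} (hU : affineObj X U) {T T' : Over ((etalePullback f).obj U)}
    {N : (finObj ((etalePullback f).obj U)).FullSubcategory} (g : T' ⟶ T) (m : T ⟶ N.obj)
    (s : F.obj (op ((fibreFunctor f hU).obj N))) :
    (extension F).map ((vertFunctor f U).map g).op (extElt hU m s) = extElt hU (g ≫ m) s := by
  rw [extElt, extElt, map_op_map, ← Functor.map_comp]

lemma extElt_comp {U : X.Etale} (hU : affineObj X U) {T : Over ((etalePullback f).obj U)}
    {N N' : (finObj ((etalePullback f).obj U)).FullSubcategory} (m : T ⟶ N'.obj) (a : N' ⟶ N)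
    (s : F.obj (op ((fibreFunctor f hU).obj N))) :
    extElt hU (m ≫ a.hom) s = extElt hU m (F.map ((fibreFunctor f hU).map a).op s) := by
  rw [extElt, extElt, extUnit_map, Functor.map_comp]
  exact (map_op_map _ _ _ _).symm

lemma extElt_baseChange {U U' : X.Etale} (hU : affineObj X U) (hU' : affineObj X U') (r : U' ⟶ U)
    {T : Over ((etalePullback f).obj U)} {N : (finObj ((etalePullback f).obj U)).FullSubcategory}
    (m : T ⟶ N.obj) (s : F.obj (op ((fibreFunctor f hU).obj N))) :
    (extension F).map (baseChangeHom f r T).op (extElt hU m s) =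
      extElt hU' (N := (finBaseChange f r).obj N)
        ((Over.pullback ((etalePullback f).map r)).map m)
        (F.map (finBaseChangeHom f hU hU' r N).op s) := by
  rw [extElt, extElt, extUnit_map, map_op_map, ← baseChangeHom_naturality f r m]
  exact (map_op_map _ _ _ _).symm

/-- Any section of the extension over `T ⟶ U`, for `U` affine, comes from a finite étale
`U_Y`-scheme. -/
lemma exists_extElt_eq {U : X.Etale} (hU : affineObj X U) {T : Over ((etalePullback f).obj U)}
    (p : (extension F).obj (op ((vertFunctor f U).obj T))) :
    ∃ (N : (finObj ((etalePullback f).obj U)).FullSubcategory) (m : T ⟶ N.obj)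
      (s : F.obj (op ((fibreFunctor f hU).obj N))), p = extElt hU m s := by
  obtain ⟨W, m, s, rfl⟩ := exists_lan_eq (smallRho f) F p
  have hW := W.property.1
  let N₀ : (finObj ((etalePullback f).obj W.obj.obj.right)).FullSubcategory :=
    ⟨Over.mk W.obj.obj.hom, W.obj.property⟩
  let c := baseChangeHom f m.right (Over.mk W.obj.obj.hom)
  have hc : IsCart c := isCart_baseChangeHom _ _ _
  let l := hc.lift (W := (vertFunctor f U).obj T) m (𝟙 U) (Category.id_comp m.right)
  have hl : l ≫ c = m := hc.lift_comp _ _ _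
  obtain ⟨n, hn⟩ := exists_vertFunctor_map l rfl
  refine ⟨(finBaseChange f m.right).obj N₀, n, F.map (finBaseChangeHom f hW hU m.right N₀).op s, ?_⟩
  rw [extElt, extUnit_map, hn]
  refine Eq.trans ?_ (map_op_map _ _ _ _).symm
  exact congr_arg (fun g : (vertFunctor f U).obj T ⟶ W.obj.obj =>
    (extension F).map g.op (extUnit s)) hl.symm

/-- In `exists_extElt_eq` the finite étale scheme may be chosen over a given one: replace it by its
fibre product with the latter over `U_Y`. -/
lemma exists_extElt_eq_of_hom {U : X.Etale} (hU : affineObj X U)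
    {T : Over ((etalePullback f).obj U)}
    (p : (extension F).obj (op ((vertFunctor f U).obj T)))
    {N₀ : (finObj ((etalePullback f).obj U)).FullSubcategory} (t : T ⟶ N₀.obj) :
    ∃ (N : (finObj ((etalePullback f).obj U)).FullSubcategory) (m : T ⟶ N.obj) (π : N ⟶ N₀)
      (s : F.obj (op ((fibreFunctor f hU).obj N))), p = extElt hU m s ∧ m ≫ π.hom = t := by
  obtain ⟨N, m, s, rfl⟩ := exists_extElt_eq F hU p
  obtain ⟨M, f₁, f₂, hM⟩ : ∃ (M : Over _) (f₁ : M ⟶ N.obj) (f₂ : M ⟶ N₀.obj),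
      IsPullback f₁ f₂ (Over.mkIdTerminal.from N.obj) (Over.mkIdTerminal.from N₀.obj) :=
    ⟨_, _, _, IsPullback.of_hasPullback _ _⟩
  have hS : finObj _ (Over.mk (𝟙 ((etalePullback f).obj U))) :=
    inferInstanceAs (IsFinite (𝟙 ((etalePullback f).obj U).left))
  let M' : (finObj ((etalePullback f).obj U)).FullSubcategory :=
    ⟨M, finObj_of_isPullback hM N.property N₀.property hS⟩
  obtain ⟨n, hn₁, hn₂⟩ : ∃ n : T ⟶ M, n ≫ f₁ = m ∧ n ≫ f₂ = t :=
    ⟨hM.lift m t (Over.mkIdTerminal.hom_ext _ _), hM.lift_fst _ _ _, hM.lift_snd _ _ _⟩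
  let a : M' ⟶ N := ObjectProperty.homMk f₁
  let b : M' ⟶ N₀ := ObjectProperty.homMk f₂
  refine ⟨M', n, b, F.map ((fibreFunctor f hU).map a).op s, ?_, hn₂⟩
  rw [← extElt_comp]
  exact congr_arg (fun m => extElt hU m s) hn₁.symm

/-- Two sections of the extension over `T ⟶ U` which come from finite étale `U_Y`-schemes are equal
if and only if they have a common refinement. -/
lemma exists_of_extElt_eq {U : X.Etale} (hU : affineObj X U) {T : Over ((etalePullback f).obj U)}
    {N N' : (finObj ((etalePullback f).obj U)).FullSubcategory} {m : T ⟶ N.obj} {m' : T ⟶ N'.obj}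
    {s : F.obj (op ((fibreFunctor f hU).obj N))} {s' : F.obj (op ((fibreFunctor f hU).obj N'))}
    (h : extElt hU m s = extElt hU m' s') :
    ∃ (M : (finObj ((etalePullback f).obj U)).FullSubcategory) (n : T ⟶ M.obj) (a : M ⟶ N)
      (b : M ⟶ N'), n ≫ a.hom = m ∧ n ≫ b.hom = m' ∧
      F.map ((fibreFunctor f hU).map a).op s = F.map ((fibreFunctor f hU).map b).op s' := by
  obtain ⟨W, n, a, b, ha, hb, hab⟩ := exists_of_lan_eq (smallRho f) F
    (W := (fibreFunctor f hU).obj N) (W' := (fibreFunctor f hU).obj N')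
    (m := (vertFunctor f U).map m) (m' := (vertFunctor f U).map m') (s := s) (s' := s') h
  have hW := W.property.1
  let N₀ : (finObj ((etalePullback f).obj W.obj.obj.right)).FullSubcategory :=
    ⟨Over.mk W.obj.obj.hom, W.obj.property⟩
  let M := (finBaseChange f n.right).obj N₀
  let c := baseChangeHom f n.right (Over.mk W.obj.obj.hom)
  let c' : (fibreFunctor f hU).obj M ⟶ W := finBaseChangeHom f hW hU n.right N₀
  have hc : IsCart c := isCart_baseChangeHom _ _ _
  let l := hc.lift (W := (vertFunctor f U).obj T) n (𝟙 U) (Category.id_comp n.right)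
  have hl : l ≫ c = n := hc.lift_comp _ _ _
  obtain ⟨k, hk⟩ := exists_vertFunctor_map l rfl
  have har : ((smallRho f).map (c' ≫ a)).right = 𝟙 U :=
    congr_arg CommaMorphism.right ha
  have hbr : ((smallRho f).map (c' ≫ b)).right = 𝟙 U :=
    congr_arg CommaMorphism.right hb
  obtain ⟨a', ha'⟩ := exists_vertFunctor_map (T := M.obj) (T' := N.obj) ((smallRho f).map (c' ≫ a)) har
  obtain ⟨b', hb'⟩ := exists_vertFunctor_map (T := M.obj) (T' := N'.obj) ((smallRho f).map (c' ≫ b)) hbr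
  have ea : (fibreFunctor f hU).map (ObjectProperty.homMk a' : M ⟶ N) = c' ≫ a :=
    (smallRho f).map_injective ha'
  have eb : (fibreFunctor f hU).map (ObjectProperty.homMk b' : M ⟶ N') = c' ≫ b :=
    (smallRho f).map_injective hb'
  refine ⟨M, k, ObjectProperty.homMk a', ObjectProperty.homMk b', (vertFunctor f U).map_injective ?_,
    (vertFunctor f U).map_injective ?_, ?_⟩
  · rw [Functor.map_comp, hk]
    change l ≫ (vertFunctor f U).map a' = _
    rw [ha', Functor.map_comp, ← ha]
    exact (Category.assoc _ _ _).symm.trans (congr_arg (fun g => g ≫ (smallRho f).map a) hl)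
  · rw [Functor.map_comp, hk]
    change l ≫ (vertFunctor f U).map b' = _
    rw [hb', Functor.map_comp, ← hb]
    exact (Category.assoc _ _ _).symm.trans (congr_arg (fun g => g ≫ (smallRho f).map b) hl)
  · rw [ea, eb, op_comp, op_comp, Functor.map_comp, Functor.map_comp, types_comp_apply,
      types_comp_apply, hab]

end Lan

end Faltings

/-! ### Restriction of sheaves to finite étale schemes over a fixed base -/

namespace Faltings

open Opposite Covanishing

variable {X Y : Scheme.{u}} {f : Y ⟶ X}

section Vertical

lemma vertSieve_left {U : X.Etale} {T T' : Over ((etalePullback f).obj U)} (g : T ⟶ T')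
    {S : Sieve ((vertFunctor f U).obj T')} (hg : S ((vertFunctor f U).map g)) :
    vertSieve S g.left := by
  have := S.downward_closed hg (show vertObj ((vertFunctor f U).obj T') g.left ⟶
    (vertFunctor f U).obj T from { left := 𝟙 _, right := 𝟙 _, w := by simp })
  rw [vertSieve_iff]
  convert! this using 1

lemma isPullback_baseChange {U U' : X.Etale} (r : U' ⟶ U) {T T' : Over ((etalePullback f).obj U)}
    (g : T ⟶ T') : IsPullback ((Over.pullback ((etalePullback f).map r)).map g).left
      (baseChangeHom f r T).left (baseChangeHom f r T').left g.left := by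
  have h₁ : IsPullback (baseChangeHom f r T).left
    ((Over.pullback ((etalePullback f).map r)).obj T).hom T.hom ((etalePullback f).map r) :=
    isCart_baseChangeHom f r T
  have h₂ : IsPullback (baseChangeHom f r T').left
    ((Over.pullback ((etalePullback f).map r)).obj T').hom T'.hom ((etalePullback f).map r) :=
    isCart_baseChangeHom f r T'
  have h := h₁.flip
  rw [← Over.w g, ← Over.w ((Over.pullback ((etalePullback f).map r)).map g)] at h
  exact IsPullback.of_right h (congr_arg CommaMorphism.left (baseChangeHom_naturality f r g))
    h₂.flip

end Vertical

variable [QuasiSeparatedSpace X] [CompactSpace Y]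

/-- The restriction of a presheaf on the small Faltings site to finite étale `U_Y`-schemes. -/
noncomputable abbrev fibrePresheaf (F : (SmallFaltingsCat f)ᵒᵖ ⥤ Type u) {U : X.Etale}
    (hU : affineObj X U) : (finObj ((etalePullback f).obj U)).FullSubcategoryᵒᵖ ⥤ Type u :=
  (fibreFunctor f hU).op ⋙ F

lemma mem_smallFaltingsTopology_iff {W : SmallFaltingsCat f} (S : Sieve W) :
    S ∈ smallFaltingsTopology f W ↔ S.functorPushforward (smallFaltingsι f) ∈
      faltingsTopology f W.obj :=
  Functor.mem_inducedTopology_iff_of_isCoverDense _ _ S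

/-- A sieve of the small Faltings site is covering if it contains the base changes along the affine
members of a covering of the base. -/
lemma mem_smallFaltingsTopology_of_baseChange {U : X.Etale} (hU : affineObj X U)
    {N : (finObj ((etalePullback f).obj U)).FullSubcategory}
    {S : Sieve ((fibreFunctor f hU).obj N)} {R : Sieve U} (hR : R ∈ X.smallEtaleTopology U)
    (h : ∀ ⦃U' : X.Etale⦄ (hU' : affineObj X U') (r : U' ⟶ U), R r →
      S (finBaseChangeHom f hU hU' r N)) :
    S ∈ smallFaltingsTopology f ((fibreFunctor f hU).obj N) := by
  rw [mem_smallFaltingsTopology_iff]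
  let R' : Sieve U := Sieve.generate fun U' r => affineObj X U' ∧ R r
  have hR' : R' ∈ X.smallEtaleTopology U := by
    refine mem_smallEtaleTopology_iff.2 fun x => ?_
    obtain ⟨U', r, hU', hr, hx⟩ := exists_affine_of_mem hR x
    exact ⟨U', r, Sieve.le_generate _ _ _ ⟨hU', hr⟩, hx⟩
  refine mem_faltingsTopology_of_cartesian (R := R') hR' fun W c hc hk => ?_
  obtain ⟨U', a, r, ⟨hU', hr⟩, har⟩ := hk
  refine ⟨_, finBaseChangeHom f hU hU' r N,
    ObjectProperty.homMk ((isCart_baseChangeHom f r N.obj).lift c.hom a har), h hU' r hr, ?_⟩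
  ext1
  exact ((isCart_baseChangeHom f r N.obj).lift_comp c.hom a har).symm

variable (F : Sheaf (smallFaltingsTopology f) (Type u))

/-- Sheaves on the small Faltings site satisfy descent for surjective families of finite étale
`U_Y`-schemes, since these are vertical coverings. Compatibility of a family of sections has to be
tested on all pairs of morphisms of the Faltings site, and these factor through the fibre products
over `U_Y`. -/
lemma isSheafFor_fibrePresheaf {U : X.Etale} (hU : affineObj X U)
    (W : (finObj ((etalePullback f).obj U)).FullSubcategory) (R : Presieve W)
    (hR : ∀ w : W.obj.left.left, ∃ (N : (finObj ((etalePullback f).obj U)).FullSubcategory)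
      (n : N ⟶ W) (x : N.obj.left.left), R n ∧ n.hom.left.left x = w) :
    R.IsSheafFor (fibrePresheaf F.obj hU) := by
  obtain ⟨ι, N, n, rfl⟩ := R.exists_eq_ofArrows
  have hmem : Sieve.ofArrows (fun i => (fibreFunctor f hU).obj (N i))
      (fun i => (fibreFunctor f hU).map (n i)) ∈
      smallFaltingsTopology f ((fibreFunctor f hU).obj W) := by
    rw [mem_smallFaltingsTopology_iff]
    refine mem_faltingsTopology_of_vertical fun w => ?_
    obtain ⟨_, _, x, ⟨i⟩, hx⟩ := hR w
    exact ⟨_, (smallFaltingsι f).map ((fibreFunctor f hU).map (n i)),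
      inferInstanceAs (IsIso (𝟙 U)), Sieve.image_mem_functorPushforward _ _
        (Sieve.ofArrows_mk _ _ i), x, hx⟩
  have hsheaf := (isSheaf_iff_isSheaf_of_type _ _).1 F.property _ hmem
  rw [Sieve.ofArrows, ← Presieve.isSheafFor_iff_generate, Presieve.isSheafFor_arrows_iff] at hsheaf
  rw [Presieve.isSheafFor_arrows_iff]
  intro x hx
  refine hsheaf x fun i j Z gi gj hg => ?_
  have hr : gi.hom.hom.right = gj.hom.hom.right := by
    have h₁ : gi.hom.hom.right ≫ 𝟙 U = gj.hom.hom.right ≫ 𝟙 U :=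
      congr_arg (fun k => k.hom.hom.right) hg
    rwa [Category.comp_id, Category.comp_id] at h₁
  have hl : gi.hom.hom.left ≫ (n i).hom.left = gj.hom.hom.left ≫ (n j).hom.left :=
    congr_arg (fun k => k.hom.hom.left) hg
  let T : Over ((etalePullback f).obj U) :=
    Over.mk (Z.obj.obj.hom ≫ (etalePullback f).map gi.hom.hom.right)
  let ti : T ⟶ (N i).obj := Over.homMk gi.hom.hom.left gi.hom.hom.w
  let tj : T ⟶ (N j).obj := Over.homMk gj.hom.hom.left (by
    refine gj.hom.hom.w.trans ?_
    rw [← hr]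
    rfl)
  have hT : ti ≫ (n i).hom = tj ≫ (n j).hom := Over.OverMorphism.ext hl
  obtain ⟨M, p, q, hM⟩ : ∃ (M : Over _) (p : M ⟶ (N i).obj) (q : M ⟶ (N j).obj),
    IsPullback p q (n i).hom (n j).hom := ⟨_, _, _, IsPullback.of_hasPullback _ _⟩
  let M' : (finObj ((etalePullback f).obj U)).FullSubcategory :=
    ⟨M, finObj_of_isPullback hM (N i).property (N j).property W.property⟩
  obtain ⟨l, hlp, hlq⟩ : ∃ l : T ⟶ M, l ≫ p = ti ∧ l ≫ q = tj :=
    ⟨hM.lift _ _ hT, hM.lift_fst _ _ _, hM.lift_snd _ _ _⟩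
  let p' : M' ⟶ N i := ObjectProperty.homMk p
  let q' : M' ⟶ N j := ObjectProperty.homMk q
  let k : Z ⟶ (fibreFunctor f hU).obj M' := ObjectProperty.homMk (ObjectProperty.homMk
    { left := l.left, right := gi.hom.hom.right, w := Over.w l })
  have hp : k ≫ (fibreFunctor f hU).map p' = gi := by
    ext1
    ext1
    exact CommaMorphism.ext (congr_arg CommaMorphism.left hlp :) (Category.comp_id _)
  have hq : k ≫ (fibreFunctor f hU).map q' = gj := by
    ext1
    ext1
    exact CommaMorphism.ext (congr_arg CommaMorphism.left hlq :) ((Category.comp_id _).trans hr)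
  have hc : F.obj.map ((fibreFunctor f hU).map p').op (x i) =
      F.obj.map ((fibreFunctor f hU).map q').op (x j) := hx i j M' p' q' (by
    ext1
    exact hM.w)
  rw [← hp, ← hq, ← map_op_map, ← map_op_map, hc]

variable {F} in
/-- Sections defining elements of the Kan extension that agree on a vertical covering are related at
every point. -/
lemma related_of_mem {U : X.Etale} (hU : affineObj X U)
    {N N' : (finObj ((etalePullback f).obj U)).FullSubcategory}
    {s : F.obj.obj (op ((fibreFunctor f hU).obj N))}
    {s' : F.obj.obj (op ((fibreFunctor f hU).obj N'))} {T : Over ((etalePullback f).obj U)}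
    (a : T ⟶ N.obj) (b : T ⟶ N'.obj) {S : Sieve T.left} (hS : S ∈ Y.smallEtaleTopology T.left)
    (h : ∀ ⦃V : Y.Etale⦄ (t : V ⟶ T.left), S t →
      extElt hU ((Over.homMk t : Over.mk (t ≫ T.hom) ⟶ T) ≫ a) s =
        extElt hU ((Over.homMk t : Over.mk (t ≫ T.hom) ⟶ T) ≫ b) s') (x : T.left.left) :
    Related (fibrePresheaf F.obj hU) s s' a b x := by
  obtain ⟨V, t, ht, v, rfl⟩ := mem_smallEtaleTopology_iff.1 hS x
  obtain ⟨M, n, α, β, hα, hβ, hαβ⟩ := exists_of_extElt_eq F.obj hU (h t ht)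
  exact (related_precomp_iff (Over.homMk t : Over.mk (t ≫ T.hom) ⟶ T) v).1
    (Related.of_eq (Φ := fibrePresheaf F.obj hU) (α := α) (β := β) hαβ n hα hβ v)

variable {F} in
/-- A sheaf on the small Faltings site is separated for the vertical coverings of the co-vanishing
site. -/
lemma eq_of_vertSieve_mem {U : X.Etale} (hU : affineObj X U)
    {N : (finObj ((etalePullback f).obj U)).FullSubcategory}
    {s s' : F.obj.obj (op ((fibreFunctor f hU).obj N))} {S : Sieve ((vertFunctor f U).obj N.obj)}
    (hS : vertSieve S ∈ Y.smallEtaleTopology N.obj.left)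
    (h : ∀ ⦃Z⦄ (g : Z ⟶ (vertFunctor f U).obj N.obj), S g →
      (extension F.obj).map g.op (extUnit s) = (extension F.obj).map g.op (extUnit s')) :
    s = s' := by
  have := eq_of_related (Φ := fibrePresheaf F.obj hU) (isSheafFor_fibrePresheaf F hU)
    (a := 𝟙 N) (b := 𝟙 N) (s := s) (s' := s') (related_of_mem hU (𝟙 N.obj) (𝟙 N.obj) hS
      fun V t ht => by
        rw [Category.comp_id]
        exact h _ ht)
  rwa [op_id, (fibrePresheaf F.obj hU).map_id] at this

end Faltings

/-! ### Local bijectivity of the unit -/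

namespace Faltings

open Opposite Covanishing

variable {X Y : Scheme.{u}} {f : Y ⟶ X}

/-- Fibre products of quasi-compact étale schemes over a finite étale `U_Y`-scheme are quasi-compact,
since the latter is quasi-separated. -/
lemma compactObj_over_pullback [QuasiSeparatedSpace X] [QuasiSeparatedSpace Y] {U : X.Etale}
    (hU : affineObj X U)
    (N : (finObj ((etalePullback f).obj U)).FullSubcategory) {T T' : Over ((etalePullback f).obj U)}
    (t : T ⟶ N.obj) (t' : T' ⟶ N.obj) (hT : compactObj Y T.left) (hT' : compactObj Y T'.left) :
    compactObj Y (pullback t t').left := by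
  have h1 : CompactSpace T.left.left := hT
  have h2 : CompactSpace T'.left.left := hT'
  have h3 : IsFinite N.obj.hom.left := N.property
  have h4 := quasiSeparatedSpace_etalePullback f hU
  have h5 : QuasiSeparatedSpace N.obj.left.left :=
    quasiSeparatedSpace_of_quasiSeparated N.obj.hom.left
  have h6 : QuasiCompact t'.left.left := quasiCompact_of_compactSpace t'.left.left
  have h7 : QuasiCompact (pullback.fst t t').left.left :=
    MorphismProperty.of_isPullback (P := @QuasiCompact)
      ((IsPullback.of_hasPullback t t').map (overScheme ((etalePullback f).obj U))).flip h6
  exact QuasiCompact.compactSpace_of_compactSpace (pullback.fst t t').left.left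

lemma exists_baseChange_preimage {U U' : X.Etale} (r : U' ⟶ U)
    {T T' : Over ((etalePullback f).obj U)} (g : T ⟶ T')
    (w : ((Over.pullback ((etalePullback f).map r)).obj T').left.left) (y : T.left.left)
    (hy : g.left.left y = (baseChangeHom f r T').left.left w) :
    ∃ v, ((Over.pullback ((etalePullback f).map r)).map g).left.left v = w := by
  obtain ⟨v, hv, -⟩ := exists_preimage_of_isPullback (isPullback_left (isPullback_baseChange r g))
    w y hy.symm
  exact ⟨v, hv⟩

/-- Sections of a sheaf which are locally equal are equal. -/
lemma ext_of_equalizerSieve_mem {G : Sheaf (covTopology f) (Type u)} {Z : CovanishingCat f}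
    {p p' : G.obj.obj (op Z)}
    (h : Presheaf.equalizerSieve (F := G.obj) (X := op Z) p p' ∈ covTopology f Z) : p = p' :=
  ((isSheaf_iff_isSheaf_of_type _ _).1 G.property _ h).isSeparatedFor.ext fun _ _ hg => hg

lemma app_map {F : (SmallFaltingsCat f)ᵒᵖ ⥤ Type u} {G : (CovanishingCat f)ᵒᵖ ⥤ Type u}
    (τ : extension F ⟶ G) {Z Z' : CovanishingCat f} (g : Z' ⟶ Z) (q : (extension F).obj (op Z)) :
    τ.app (op Z') ((extension F).map g.op q) = G.map g.op (τ.app (op Z) q) :=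
  NatTrans.naturality_apply τ g.op q

variable [QuasiSeparatedSpace X] [CompactSpace Y]

/-- The objects of the small Faltings site are the finite étale `U_Y`-schemes, for `U` affine. -/
lemma exists_fibreFunctor_obj (W : SmallFaltingsCat f) : ∃ (U : X.Etale) (hU : affineObj X U)
    (N : (finObj ((etalePullback f).obj U)).FullSubcategory), W = (fibreFunctor f hU).obj N :=
  ⟨W.obj.obj.right, W.property.1, ⟨Over.mk W.obj.obj.hom, W.obj.property⟩, rfl⟩

variable {F : Sheaf (smallFaltingsTopology f) (Type u)} {G : Sheaf (covTopology f) (Type u)}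
  (τ : extension F.obj ⟶ G.obj)

lemma isLocallyInjective_unit [Presheaf.IsLocallyInjective (covTopology f) τ] :
    Presheaf.IsLocallyInjective (smallFaltingsTopology f) ((smallRho f).op.lanUnit.app F.obj ≫
      Functor.whiskerLeft (smallRho f).op τ) where
  equalizerSieve_mem {W} s s' h := by
    induction W using Opposite.rec with | op W
    obtain ⟨U, hU, N, rfl⟩ := exists_fibreFunctor_obj W
    have hS : Presheaf.equalizerSieve (F := extension F.obj)
        (X := op ((vertFunctor f U).obj N.obj)) (extUnit s) (extUnit s') ∈ covTopology f _ :=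
      Presheaf.equalizerSieve_mem _ τ _ _ h
    have hR := refinementSieve_mem (isFinitary f) hU ((fibreFunctor f hU).obj N).property.2 hS
    refine mem_smallFaltingsTopology_of_baseChange hU hR fun U' hU' r hr => ?_
    change F.obj.obj (op ((fibreFunctor f hU).obj N)) at s s'
    change F.obj.map (finBaseChangeHom f hU hU' r N).op s =
      F.obj.map (finBaseChangeHom f hU hU' r N).op s'
    refine eq_of_vertSieve_mem hU' (hr (baseChangeHom f r N.obj) (𝟙 _)
      (isCart_baseChangeHom f r N.obj) (Category.id_comp _).symm) fun Z g hg => ?_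
    rw [extUnit_map, extUnit_map]
    exact (map_op_map _ _ _ _).trans (Eq.trans hg (map_op_map _ _ _ _).symm)

/-- A section `p` of `ρ^* F` over a finite étale `U_Y`-scheme which comes from the Kan extension on a
vertical covering comes from `F` after base change along a covering of `U`. The covering of `U` is
chosen such that the given lifts of `p` agree étale-locally on the intersections; then the lifts
satisfy the hypotheses of `exists_descent`. -/
lemma exists_extUnit_eq_of_vertSieve_mem [QuasiSeparatedSpace Y]
    [Presheaf.IsLocallyInjective (covTopology f) τ] (hY : IsEtaleLocallyConnected Y) {U : X.Etale}
    (hU : affineObj X U) (N : (finObj ((etalePullback f).obj U)).FullSubcategory)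
    (p : G.obj.obj (op ((vertFunctor f U).obj N.obj)))
    (hp : vertSieve (Presheaf.imageSieve τ p) ∈ Y.smallEtaleTopology N.obj.left) :
    ∃ R ∈ X.smallEtaleTopology U, ∀ ⦃U' : X.Etale⦄ (hU' : affineObj X U') (r : U' ⟶ U), R r →
      ∃ x : F.obj.obj (op ((fibreFunctor f hU').obj ((finBaseChange f r).obj N))),
        τ.app _ (extUnit x) = G.obj.map (baseChangeHom f r N.obj).op p := by
  obtain ⟨n, V, t, hV, ht, htc⟩ :=
    exists_finite_refinement ((fibreFunctor f hU).obj N).property.2 hp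
  let V' (i) : Over ((etalePullback f).obj U) := Over.mk (t i ≫ N.obj.hom)
  let t' (i) : V' i ⟶ N.obj := Over.homMk (t i)
  have hq (i) : ∃ q : (extension F.obj).obj (op ((vertFunctor f U).obj (V' i))),
      τ.app _ q = G.obj.map ((vertFunctor f U).map (t' i)).op p := ht i
  choose q hq using hq
  choose W φ π s hs hφ using fun i => exists_extElt_eq_of_hom F.obj hU (q i) (t' i)
  -- the lifts `q i` and `q j` of `p` agree on the sieve `S i j`, since `τ` is locally injective
  let S (i j) : Sieve ((vertFunctor f U).obj (pullback (t' i) (t' j))) :=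
    Presheaf.equalizerSieve (F := extension F.obj)
      (X := op ((vertFunctor f U).obj (pullback (t' i) (t' j))))
      ((extension F.obj).map ((vertFunctor f U).map (pullback.fst (t' i) (t' j))).op (q i))
      ((extension F.obj).map ((vertFunctor f U).map (pullback.snd (t' i) (t' j))).op (q j))
  have hS (i j) : S i j ∈ covTopology f _ := by
    refine Presheaf.equalizerSieve_mem _ τ _ _ ?_
    rw [app_map, app_map, hq, hq, map_op_map, map_op_map, ← Functor.map_comp, ← Functor.map_comp,
      pullback.condition]
  let R (i j) : Sieve U := refinementSieve Y.smallEtaleTopology (S i j)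
  refine ⟨⨅ i, ⨅ j, R i j, finite_iInf_mem _ _ fun i => finite_iInf_mem _ _ fun j =>
    refinementSieve_mem (isFinitary f) hU
      (compactObj_over_pullback hU N (t' i) (t' j) (hV i) (hV j)) (hS i j), fun U' hU' r hr => ?_⟩
  let B := Over.pullback ((etalePullback f).map r)
  have hcov (w : (B.obj N.obj).left.left) : ∃ (i : Fin n) (v : (B.obj (V' i)).left.left),
      (B.map (t' i)).left.left v = w := by
    rw [Scheme.ofArrows_mem_smallEtaleTopology_iff, Set.eq_univ_iff_forall] at htc
    obtain ⟨i, y, hy⟩ := Set.mem_iUnion.1 (htc ((baseChangeHom f r N.obj).left.left w))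
    exact ⟨i, exists_baseChange_preimage r (t' i) w y hy⟩
  have hBφ (i) : B.map (φ i) ≫ B.map (π i).hom = B.map (t' i) := by
    rw [← B.map_comp, hφ]
  obtain ⟨x, hx⟩ := exists_descent hY (isSheafFor_fibrePresheaf F hU')
    (W := (finBaseChange f r).obj N) (Wᵢ := fun i => (finBaseChange f r).obj (W i))
    (fun i => (finBaseChange f r).map (π i))
    (fun i => F.obj.map (finBaseChangeHom f hU hU' r (W i)).op (s i))
    (V := fun i => B.obj (V' i)) (fun i => B.map (φ i)) (fun w => by
      obtain ⟨i, v, hv⟩ := hcov w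
      refine ⟨i, v, ?_⟩
      rw [← hv, ← hBφ]
      rfl) (by
      intro i j T a b hab z
      change a ≫ B.map (φ i) ≫ B.map (π i).hom = b ≫ B.map (φ j) ≫ B.map (π j).hom at hab
      rw [hBφ, hBφ] at hab
      have sq := (IsPullback.of_hasPullback (t' i) (t' j)).map B
      obtain ⟨l, rfl, rfl⟩ : ∃ l, l ≫ B.map (pullback.fst (t' i) (t' j)) = a ∧
          l ≫ B.map (pullback.snd (t' i) (t' j)) = b :=
        ⟨sq.lift a b hab, sq.lift_fst _ _ _, sq.lift_snd _ _ _⟩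
      have hrij : R i j r :=
        (iInf_le (fun i => ⨅ j, R i j) i).trans (iInf_le (fun j => R i j) j) _ hr
      rw [Category.assoc, Category.assoc, related_precomp_iff, ← B.map_comp, ← B.map_comp]
      refine related_of_mem hU' _ _ (hrij (baseChangeHom f r (pullback (t' i) (t' j))) (𝟙 _)
        (isCart_baseChangeHom f r _) (Category.id_comp _).symm) (fun Z g hg => ?_) _
      rw [← extElt_map, ← extElt_map, ← extElt_baseChange, ← extElt_baseChange, ← extElt_map,
        ← extElt_map, ← hs, ← hs, map_op_map, map_op_map _ (baseChangeHom f r _)]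
      exact hg)
  refine ⟨x, ext_of_equalizerSieve_mem (mem_covTopology_of_vertical f
    (mem_smallEtaleTopology_iff.2 fun w => ?_))⟩
  obtain ⟨i, v, rfl⟩ := hcov w
  refine ⟨_, (B.map (t' i)).left, vertSieve_left (B.map (t' i)) ?_, v, rfl⟩
  obtain ⟨M, m, l, hl, hlx⟩ := hx i
  have e : extElt hU' (B.map (t' i)) x =
      (extension F.obj).map (baseChangeHom f r (V' i)).op (q i) := by
    have e₁ : l ≫ (m ≫ (finBaseChange f r).map (π i)).hom = B.map (t' i) := by
      rw [← hBφ, ← hl, Category.assoc]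
      rfl
    rw [← e₁, extElt_comp]
    refine (congr_arg (extElt hU' l) hlx).trans ?_
    refine (extElt_comp _ _ _ _ _).symm.trans ?_
    refine (congr_arg (fun g => extElt hU' g _) hl).trans ?_
    rw [hs, extElt_baseChange F.obj hU hU' r (φ i) (s i)]
  change G.obj.map ((vertFunctor f U').map (B.map (t' i))).op (τ.app _ (extUnit x)) =
    G.obj.map ((vertFunctor f U').map (B.map (t' i))).op (G.obj.map (baseChangeHom f r N.obj).op p)
  refine (app_map τ _ _).symm.trans ((congr_arg (τ.app _) e).trans ?_)
  rw [app_map, hq, map_op_map, map_op_map, baseChangeHom_naturality]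

lemma isLocallySurjective_unit [QuasiSeparatedSpace Y]
    [Presheaf.IsLocallyInjective (covTopology f) τ] [Presheaf.IsLocallySurjective (covTopology f) τ]
    (hY : IsEtaleLocallyConnected Y) :
    Presheaf.IsLocallySurjective (smallFaltingsTopology f) ((smallRho f).op.lanUnit.app F.obj ≫
      Functor.whiskerLeft (smallRho f).op τ) where
  imageSieve_mem {W} p := by
    obtain ⟨U, hU, N, rfl⟩ := exists_fibreFunctor_obj W
    change G.obj.obj (op ((vertFunctor f U).obj N.obj)) at p
    let S := Presheaf.imageSieve ((smallRho f).op.lanUnit.app F.obj ≫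
      Functor.whiskerLeft (smallRho f).op τ) (U := (fibreFunctor f hU).obj N) p
    -- the quantification over `l` makes `R` a sieve by construction
    let R : Sieve U :=
      { arrows := fun U' h => ∀ ⦃U'' : X.Etale⦄ (hU'' : affineObj X U'') (l : U'' ⟶ U'),
          S (finBaseChangeHom f hU hU'' (l ≫ h) N)
        downward_closed := fun {U' U''} h hh l U₃ hU₃ l' => by
          rw [← Category.assoc]
          exact hh hU₃ (l' ≫ l) }
    have hτ : Presheaf.imageSieve τ (U := (vertFunctor f U).obj N.obj) p ∈ covTopology f _ :=
      Presheaf.imageSieve_mem (covTopology f) τ (U := op ((vertFunctor f U).obj N.obj)) p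
    have hR : R ∈ X.smallEtaleTopology U := by
      refine (isFinitary f).mem_of_forall (refinementSieve_mem (isFinitary f) hU
        ((fibreFunctor f hU).obj N).property.2 hτ) fun U' k hU' hk => ?_
      have hp := hk (baseChangeHom f k N.obj) (𝟙 _)
        (isCart_baseChangeHom f k N.obj) (Category.id_comp _).symm
      beta_reduce at hp
      rw [Presheaf.pullback_imageSieve] at hp
      obtain ⟨R', hR', h⟩ := exists_extUnit_eq_of_vertSieve_mem τ hY hU'
        ((finBaseChange f k).obj N) _ hp
      refine X.smallEtaleTopology.superset_covering (fun U₁ a ha U₂ hU₂ b => ?_) hR'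
      obtain ⟨x, hx⟩ := h hU₂ (b ≫ a) (R'.downward_closed ha b)
      have hc := (isCart_baseChangeHom f k N.obj).comp
        (isCart_baseChangeHom f (b ≫ a) ((finBaseChange f k).obj N).obj)
      -- the comparison of the base change along `b ≫ a ≫ k` with the iterated base change
      let e₀ := hc.lift (baseChangeHom f (b ≫ a ≫ k) N.obj) (𝟙 _)
        ((Category.id_comp _).trans (Category.assoc _ _ _))
      have he₀ := hc.lift_comp (baseChangeHom f (b ≫ a ≫ k) N.obj) (𝟙 _)
        ((Category.id_comp _).trans (Category.assoc _ _ _))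
      let e : (fibreFunctor f hU₂).obj ((finBaseChange f (b ≫ a ≫ k)).obj N) ⟶
          (fibreFunctor f hU₂).obj ((finBaseChange f (b ≫ a)).obj ((finBaseChange f k).obj N)) :=
        ObjectProperty.homMk (ObjectProperty.homMk e₀)
      refine ⟨F.obj.map e.op x, ?_⟩
      change τ.app _ (extUnit (F.obj.map e.op x)) =
        G.obj.map (baseChangeHom f (b ≫ a ≫ k) N.obj).op p
      rw [extUnit_map, app_map, hx]
      refine (congr_arg _ (map_op_map _ _ _ _)).trans ((map_op_map _ _ _ _).trans ?_)
      exact congr_arg (fun g => G.obj.map (Quiver.Hom.op g) p) he₀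
    refine mem_smallFaltingsTopology_of_baseChange hU hR fun U' hU' r hr => ?_
    have := hr hU' (𝟙 _)
    rwa [Category.id_comp] at this

end Faltings

/-! ### Full faithfulness from local bijectivity of the unit -/

namespace Faltings

open Opposite Covanishing

section Formal

/-- Full faithfulness of the sheaf pullback along `G`, when the canonical maps from sheaves to
the restrictions of their pullbacks are locally bijective. -/
lemma full_and_faithful_sheafPullback {C D : Type*} [Category* C] [Category* D] (G : C ⥤ D)
    (J : GrothendieckTopology C) (K : GrothendieckTopology D) [G.IsContinuous J K]
    [HasWeakSheafify K (Type u)] [∀ F : Cᵒᵖ ⥤ Type u, G.op.HasLeftKanExtension F]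
    (h : ∀ F : Sheaf J (Type u),
      Presheaf.IsLocallyInjective J (G.op.lanUnit.app F.obj ≫
        Functor.whiskerLeft G.op (toSheafify K (G.op.lan.obj F.obj))) ∧
      Presheaf.IsLocallySurjective J (G.op.lanUnit.app F.obj ≫
        Functor.whiskerLeft G.op (toSheafify K (G.op.lan.obj F.obj)))) :
    (Functor.sheafPullbackConstruction.sheafPullback G (Type u) J K).Full ∧
      (Functor.sheafPullbackConstruction.sheafPullback G (Type u) J K).Faithful := by
  let adj := Functor.sheafPullbackConstruction.sheafAdjunctionContinuous G (Type u) J K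
  -- the unit is the canonical map from `F` to the restriction of the sheafified Kan extension
  have hu (F : Sheaf J (Type u)) : (adj.unit.app F).hom = G.op.lanUnit.app F.obj ≫
        Functor.whiskerLeft G.op (toSheafify K (G.op.lan.obj F.obj)) := by
    have := Adjunction.map_restrictFullyFaithful_unit_app ((G.op.lanAdjunction (Type u)).comp
        (sheafificationAdjunction K (Type u))) (fullyFaithfulSheafToPresheaf J (Type u))
      (Functor.FullyFaithful.id _)
      (L := Functor.sheafPullbackConstruction.sheafPullback G (Type u) J K)
      (R := G.sheafPushforwardContinuous (Type u) J K) (Iso.refl _) (Iso.refl _) F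
    refine this.trans ?_
    simp only [Adjunction.comp_unit_app, Category.assoc]
    congr 1
  have : J.HasSheafCompose (forget (Type u)) :=
    ⟨fun P hP => (Presheaf.isSheaf_of_iso_iff (Iso.refl P : P ≅ P ⋙ forget (Type u))).1 hP⟩
  have : IsIso adj.unit := by
    have (F : Sheaf J (Type u)) : IsIso (adj.unit.app F) := by
      refine (Sheaf.isLocallyBijective_iff_isIso (adj.unit.app F)).1 ?_
      constructor
      · change Presheaf.IsLocallyInjective J (adj.unit.app F).hom
        rw [hu]
        exact (h F).1
      · change Presheaf.IsLocallySurjective J (adj.unit.app F).hom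
        rw [hu]
        exact (h F).2
    exact NatIso.isIso_of_isIso_app _
  exact ⟨adj.fullyFaithfulLOfIsIsoUnit.full, adj.fullyFaithfulLOfIsIsoUnit.faithful⟩

end Formal

end Faltings

open Faltings in
theorem proposition10p12 {X Y : AlgebraicGeometry.Scheme.{u}} (f : Y ⟶ X) [QuasiSeparatedSpace X]
    [CompactSpace Y] [QuasiSeparatedSpace Y] (hY : Faltings.IsEtaleLocallyConnected Y) :
    ∃ _ : (Faltings.rhoDirectImage f).IsRightAdjoint,
      (Faltings.rhoPullback f).Full ∧ (Faltings.rhoPullback f).Faithful := by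
  let res := (smallFaltingsι f).sheafPushforwardContinuous (Type u) (smallFaltingsTopology f)
    (faltingsTopology f)
  let L := Functor.sheafPullbackConstruction.sheafPullback (smallRho f) (Type u)
    (smallFaltingsTopology f) (covTopology f)
  have key : L.Full ∧ L.Faithful := full_and_faithful_sheafPullback.{u} (smallRho f) _ _
    fun F => ⟨isLocallyInjective_unit _, isLocallySurjective_unit _ hY⟩
  -- restriction to the small Faltings site is an equivalence `res`, and `res ⋙ L` is left adjoint
  -- to `ρ_*`
  let e : (smallRho f).sheafPushforwardContinuous (Type u) (smallFaltingsTopology f)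
      (covTopology f) ≅ rhoDirectImage f ⋙ res := Iso.refl _
  let adj : L ⊣ rhoDirectImage f ⋙ res :=
    (Functor.sheafPullbackConstruction.sheafAdjunctionContinuous (smallRho f) (Type u)
      (smallFaltingsTopology f) (covTopology f)).ofNatIsoRight e
  let adj' : res ⋙ L ⊣ rhoDirectImage f :=
    (res.asEquivalence.toAdjunction.comp adj).ofNatIsoRight
      (Functor.isoWhiskerLeft (rhoDirectImage f) res.asEquivalence.unitIso.symm ≪≫
        Functor.rightUnitor _)
  have hadj : (rhoDirectImage f).IsRightAdjoint := adj'.isRightAdjoint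
  have := key.1
  have := key.2
  let i : res ⋙ L ≅ rhoPullback f :=
    adj'.leftAdjointUniq (Adjunction.ofIsRightAdjoint (rhoDirectImage f))
  exact ⟨hadj, Functor.Full.of_iso i, Functor.Faithful.of_iso i⟩
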